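/- Let $\mathbb{F}$ be a field and let $\mathscr{D}$ be an $\mathbb{F}$-linear triangulated category with a bounded $t$-structure whose heart $\mathscr{M}$ is a finite-length abelian category. Let $\mathrm{Irr}(\mathscr{M})$ be the set of isomorphism classes of simple objects, and let $\mathrm{wt}:\mathrm{Irr}(\mathscr{M})\to\mathbb{Z}$ be a function for which $\mathscr{D}$ is mixed, i.e. $\mathrm{Hom}_{\mathscr{D}}(L,L'[i])=0$ whenever $L,L'\in\mathscr{M}$ are simple and $\mathrm{wt}(L')>\mathrm{wt}(L)-i$. For $S\subset\mathbb{Z}$ let $\mathscr{M}_S$ be the Serre subcategory of $\mathscr{M}$ generated by the simple objects with weight in $S$; write $\mathscr{M}_n$ for $S=\{n\}$ and $\mathscr{M}_{[n,n+1]}$ for $S=\{n,n+1\}$. Let $\mathsf{Pure}(\mathscr{D})\subset\mathscr{D}$ be the full subcategory of objects $X$ with $H^i(X)\in\mathscr{M}_i$ for all $i\in\mathbb{Z}$, where $H^i$ is cohomology for the $t$-structure. Its indecomposable objects are, up to isomorphism, the $L[-\mathrm{wt}\,L]$ with $L\in\mathscr{M}$ simple; set $\deg(L[-\mathrm{wt}\,L])=\mathrm{wt}\,L$.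 Assume that $\mathrm{End}(L)\cong\mathbb{F}$ for every simple $L\in\mathscr{M}$ and that $\dim_{\mathbb{F}}\mathrm{Hom}(X,Y)<\infty$ for all $X,Y\in\mathsf{Pure}(\mathscr{D})$. The winnowing $\mathscr{M}^\diamondsuit$ is the full subcategory of the bounded homotopy category $K^{\mathrm b}\mathsf{Pure}(\mathscr{D})$ consisting of the objects isomorphic to a bounded complex $C^\bullet$ in which each $C^i$ is a finite direct sum of indecomposable objects of degree $-i$. A simple object of $\mathscr{M}^\diamondsuit$ has weight $n$ if it is isomorphic to $S[n]$ for some indecomposable $S\in\mathsf{Pure}(\mathscr{D})$ of degree $n$ (that is, to the complex with $S$ in degree $-n$ and $0$ elsewhere); $\mathscr{M}^\diamondsuit_n$ and $\mathscr{M}^\diamondsuit_{[n,n+1]}$ denote the Serre subcategories of $\mathscr{M}^\diamondsuit$ generated by the simple objects of weight $n$, respectively of weight $n$ or $n+1$. Then $\mathscr{M}^\diamondsuit$ is an abelian category, and there is an exact, faithful, $\mathbb{F}$-linear functor $\beta:\mathscr{M}\to\mathscr{M}^\diamondsuit$ that preserves weights (it sends each simple object of weight $n$ to a simple object of weight $n$)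 and such that, for every $n\in\mathbb{Z}$, it restricts to equivalences of categories $\mathscr{M}_n\to\mathscr{M}^\diamondsuit_n$ and $\mathscr{M}_{[n,n+1]}\to\mathscr{M}^\diamondsuit_{[n,n+1]}$. -/

import Mathlib

open CategoryTheory CategoryTheory.Limits CategoryTheory.Triangulated

namespace Winnow

universe v u v' u'

section Abelian

variable (M : Type u') [Category.{v'} M]

/-- The set of isomorphism classes of simple objects. -/
def Irr [HasZeroMorphisms M] : Type u' :=
  Quotient (isIsomorphicSetoid (ObjectProperty.FullSubcategory (fun X : M => Simple X)))

variable {M}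

/-- The isomorphism class of a simple object. -/
def irrClass [HasZeroMorphisms M] (L : M) (hL : Simple L) : Irr M :=
  Quotient.mk (isIsomorphicSetoid _)
    (⟨L, hL⟩ : ObjectProperty.FullSubcategory (fun X : M => Simple X))

/-- The Serre subcategory generated by the objects satisfying `P`: the intersection of all
classes of objects that contain zero and `P` and are closed under subobjects, quotients and
extensions. -/
def serreGenerated [HasZeroMorphisms M] (P : ObjectProperty M) : ObjectProperty M := fun X =>
  ∀ Q : ObjectProperty M, Q.ContainsZero → Q.IsClosedUnderSubobjects →
    Q.IsClosedUnderQuotients → Q.IsClosedUnderExtensions → P ≤ Q → Q X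

/-- The Serre subcategory generated by the simple objects whose weight lies in `S`. -/
def weightPart [HasZeroMorphisms M] (wt : Irr M → ℤ) (S : Set ℤ) : ObjectProperty M :=
  serreGenerated fun L => ∃ hL : Simple L, wt (irrClass L hL) ∈ S

end Abelian

section Bounded

variable (A : Type u) [Category.{v} A] [Preadditive A]

/-- The bounded complexes, as a class of objects of the homotopy category. -/
def bounded : ObjectProperty (HomotopyCategory A (ComplexShape.up ℤ)) := fun K =>
  ∃ a b : ℤ, CochainComplex.IsStrictlyGE K.as a ∧ CochainComplex.IsStrictlyLE K.as b

/-- The bounded homotopy category of an additive category. -/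
abbrev Kb := (bounded A).FullSubcategory

end Bounded

section Triangulated

variable {D : Type u} [Category.{v} D] [Preadditive D] [HasZeroObject D] [HasShift D ℤ]
  [∀ n : ℤ, (shiftFunctor D n).Additive] [Pretriangulated D] [IsTriangulated D]
  (t : TStructure D)
  {M : Type u'} [Category.{v'} M] [Abelian M] [t.Heart M]
  (wt : Irr M → ℤ)

/-- The cohomology object `Hⁱ(X) = (τ≥i τ≤i X)[i]`, as an object of the triangulated category. -/
noncomputable def coh (i : ℤ) (X : D) : D := ((t.truncGELE i i).obj X)⟦i⟧

/-- The heart `M` of the `t`-structure `t`, with the function `wt`, makes the triangulated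
category mixed: the `t`-structure is bounded, `M` is a finite-length category, and
`Hom(L, L'[i]) = 0` for simple objects `L`, `L'` with `wt L' > wt L - i`. -/
structure IsMixed : Prop where
  bounded (X : D) : t.bounded X
  finiteLength (X : M) : IsArtinianObject X ∧ IsNoetherianObject X
  hom_eq_zero (L L' : M) (hL : Simple L) (hL' : Simple L') (i : ℤ)
    (h : wt (irrClass L hL) - i < wt (irrClass L' hL'))
    (f : t.ιHeart.obj L ⟶ (t.ιHeart.obj L')⟦i⟧) : f = 0

/-- The class of objects `X` with `Hⁱ(X) ∈ M_i` for all `i`. -/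
def isPure : ObjectProperty D := fun X =>
  ∀ i : ℤ, ∃ A : M, weightPart wt {i} A ∧ Nonempty (t.ιHeart.obj A ≅ coh t i X)

/-- The full subcategory `Pure(D)`. -/
abbrev PureCat := (isPure t wt).FullSubcategory

/-- The indecomposable objects of degree `d` of `Pure(D)`: those isomorphic to `L[-wt L]` with
`L` a simple object of `M` such that `wt L = d`. -/
def indecOfDegree (d : ℤ) : ObjectProperty (PureCat t wt) := fun S =>
  ∃ (L : M) (hL : Simple L), wt (irrClass L hL) = d ∧
    Nonempty (S.obj ≅ (t.ιHeart.obj L)⟦-d⟧)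

/-- The finite direct sums of indecomposable objects of degree `d`. -/
def sumOfDegree (d : ℤ) : ObjectProperty (PureCat t wt) := fun X =>
  ∃ (n : ℕ) (S : Fin n → PureCat t wt) (b : Bicone S),
    (∀ k, indecOfDegree t wt d (S k)) ∧ Nonempty b.IsBilimit ∧ Nonempty (X ≅ b.pt)

/-- The objects of `Kᵇ Pure(D)` that are isomorphic to a bounded complex whose `i`-th term is,
for every `i`, a sum of indecomposable objects of degree `-i`. -/
def winnowing : ObjectProperty (Kb (PureCat t wt)) := fun X =>
  ∃ C : Kb (PureCat t wt), Nonempty (X ≅ C) ∧ ∀ i : ℤ, sumOfDegree t wt (-i) (C.obj.as.X i)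

/-- The winnowing of `M`. -/
abbrev Winnowing := (winnowing t wt).FullSubcategory

/-- `L` is a simple object of weight `n` of the winnowing: it is simple, and it is isomorphic to
`S[n]` (the complex with `S` in degree `-n` and zero elsewhere) for an indecomposable object
`S` of `Pure(D)` of degree `n`. -/
def winnowingSimple (n : ℤ) : ObjectProperty (Winnowing t wt) := fun L =>
  Simple L ∧ ∃ C : Kb (PureCat t wt), Nonempty (L.obj ≅ C) ∧
    indecOfDegree t wt n (C.obj.as.X (-n)) ∧ ∀ i : ℤ, i ≠ -n → IsZero (C.obj.as.X i)

/-- The Serre subcategory of the winnowing generated by the simple objects whose weight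
lies in `S`. -/
def winnowingWeightPart (S : Set ℤ) : ObjectProperty (Winnowing t wt) :=
  serreGenerated fun L => ∃ n ∈ S, winnowingSimple t wt n L

/-- A functor from `M` to the winnowing preserves weights if it sends every simple object to a
simple object of the same weight. -/
def PreservesWeights (β : M ⥤ Winnowing t wt) : Prop :=
  ∀ (L : M) (hL : Simple L), winnowingSimple t wt (wt (irrClass L hL)) (β.obj L)

/-- `β` restricts to an equivalence from the full subcategory `P` to the full subcategory `Q`. -/
def RestrictsToEquivalence {A : Type*} [Category* A] {B : Type*} [Category* B]
    (β : A ⥤ B) (P : ObjectProperty A) (Q : ObjectProperty B) : Prop :=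
  ∃ h : ∀ X : A, P X → Q (β.obj X),
    (Q.lift (P.ι ⋙ β) fun X => h X.obj X.property).IsEquivalence

end Triangulated

/-- The category `C`, with its given preadditive structure, is abelian. -/
def IsAbelian (C : Type u) [Category.{v} C] [Preadditive C] : Prop :=
  ∃ ab : Abelian C, ab.toPreadditive = ‹Preadditive C›

end Winnow

/-! Mixedness kills `Hom(L, L'[1])` as soon as `wt L ≤ wt L'`. Two consequences drive everything.
Each category of objects of a single weight is semisimple. Every object `X` of the heart has a
weight filtration, with low weights as subobjects: `F i X` is the largest subobject of weights `≤
-i`, and `X / F i X` has weights `> -i`. There are no nonzero morphisms between objects with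
disjoint sets of weights, so the filtration is functorial and strict, and the graded pieces `gr i
X`, of weight `-i`, are exact functors of `X`.

The extension of `gr i X` by `F (i + 1) X`, pushed out to `gr (i + 1) X`, is a class `gr i X ⟶ (gr
(i + 1) X)[1]`. Consecutive classes compose to zero, because two consecutive maps of a triangle do
(`grδ_comp_grδ`). After shifting the `i`-th piece by `i`, they form a complex in `Pure(D)` whose
`i`-th term has degree `-i`, that is, an object of the winnowing. This is `β`.

To control the target, the winnowing is replaced by the equivalent category `LinearComplex` of such
sequences in the heart. The equivalence holds because a homotopy would have components `A[i] ⟶ B[i -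
1]` with `A`, `B` in the heart, and these vanish for the `t`-structure (`eq_of_homotopy`). Homotopy
classes are therefore honest chain maps. Linear complexes form an abelian category with degreewise
kernels and cokernels: every term is semisimple, so all degreewise sequences split and the
differentials restrict to subobjects and descend to quotients (`nonempty_abelianStruct`). Exactness
and faithfulness of `β` are then those of the functors `gr i` taken together.

With two consecutive weights, an object of the heart is one extension and a linear complex is one
class in `Hom(A, B[1])`. Completion of morphisms of triangles gives fullness
(`exists_toLinear_map_eq`), and every class is realised by an extension (`exists_toLinear_obj_iso`).
The one-weight case is contained in this one. -/

namespace Winnow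

set_option linter.unusedSectionVars false

open Pretriangulated ZeroObject

/-! ### Exact sequences attached to distinguished triangles -/

section Distinguished

variable {D : Type*} [Category* D] [Preadditive D] [HasZeroObject D] [HasShift D ℤ]
  [∀ n : ℤ, (shiftFunctor D n).Additive] [Pretriangulated D]
  {A B C A' B' C' : D} {f : A ⟶ B} {g : B ⟶ C} {h : C ⟶ A⟦(1 : ℤ)⟧}
  {f' : A' ⟶ B'} {g' : B' ⟶ C'} {h' : C' ⟶ A'⟦(1 : ℤ)⟧}

lemma distinguished_of_iso (hT : Triangle.mk f g h ∈ distTriang D)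
    (a : A' ≅ A) (b : B' ≅ B) (c : C' ≅ C) (h₁ : f' ≫ b.hom = a.hom ≫ f)
    (h₂ : g' ≫ c.hom = b.hom ≫ g) (h₃ : h' ≫ a.hom⟦1⟧' = c.hom ≫ h) :
    Triangle.mk f' g' h' ∈ distTriang D :=
  isomorphic_distinguished _ hT _ (Triangle.isoMk _ _ a b c h₁ h₂ h₃)

lemma distinguished_complete₃ (hT : Triangle.mk f g h ∈ distTriang D)
    (hT' : Triangle.mk f' g' h' ∈ distTriang D) (a : A ⟶ A') (b : B ⟶ B')
    (w : f ≫ b = a ≫ f') : ∃ c : C ⟶ C', g ≫ c = b ≫ g' ∧ h ≫ a⟦1⟧' = c ≫ h' :=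
  complete_distinguished_triangle_morphism _ _ hT hT' a b w

lemma distinguished_complete₂ (hT : Triangle.mk f g h ∈ distTriang D)
    (hT' : Triangle.mk f' g' h' ∈ distTriang D) (a : A ⟶ A') (c : C ⟶ C')
    (w : h ≫ a⟦1⟧' = c ≫ h') : ∃ b : B ⟶ B', f ≫ b = a ≫ f' ∧ g ≫ c = b ≫ g' :=
  complete_distinguished_triangle_morphism₂ _ _ hT hT' a c w

lemma distinguished_yoneda₃ (hT : Triangle.mk f g h ∈ distTriang D) {Y : D} (k : C ⟶ Y)
    (w : g ≫ k = 0) : ∃ l : A⟦(1 : ℤ)⟧ ⟶ Y, k = h ≫ l :=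
  Triangle.yoneda_exact₃ _ hT k w

lemma distinguished_yoneda₂ (hT : Triangle.mk f g h ∈ distTriang D) {Y : D} (k : B ⟶ Y)
    (w : f ≫ k = 0) : ∃ l : C ⟶ Y, k = g ≫ l :=
  Triangle.yoneda_exact₂ _ hT k w

/-- The extension is the middle component of a morphism to the contractible triangle `Y ⟶ Y ⟶ 0`;
the hypothesis is the vanishing of the obstruction to extending `k`. -/
lemma distinguished_yoneda₁ (hT : Triangle.mk f g h ∈ distTriang D) {Y : D} (k : A ⟶ Y)
    (w : h ≫ k⟦1⟧' = 0) : ∃ l : B ⟶ Y, f ≫ l = k := by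
  obtain ⟨l, hl, -⟩ := distinguished_complete₂ hT (contractible_distinguished Y) k 0
    (by simpa using w)
  exact ⟨l, by simpa using hl⟩

lemma distinguished_coyoneda₂_shift (hT : Triangle.mk f g h ∈ distTriang D) {Y : D}
    (k : Y ⟶ B⟦(1 : ℤ)⟧) (w : k ≫ g⟦1⟧' = 0) : ∃ l : Y ⟶ A⟦(1 : ℤ)⟧, k = l ≫ f⟦1⟧' := by
  obtain ⟨l, hl⟩ : ∃ l : Y ⟶ A⟦(1 : ℤ)⟧, k = l ≫ (-f⟦1⟧') :=
    Triangle.coyoneda_exact₁ _ (rot_of_distTriang _ hT) k w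
  exact ⟨-l, by rw [hl, Preadditive.comp_neg, Preadditive.neg_comp]⟩

end Distinguished

/-! ### Short exact sequences and extensions in the heart -/

section Heart

variable {D : Type*} [Category* D] [Preadditive D] [HasZeroObject D] [HasShift D ℤ]
  [∀ n : ℤ, (shiftFunctor D n).Additive] [Pretriangulated D] [IsTriangulated D]
  (t : TStructure D) {M : Type*} [Category* M] [Abelian M] [t.Heart M]

lemma heart_hom_shift_neg_eq_zero ⦃X Y : M⦄ ⦃n : ℤ⦄
    (f : t.ιHeart.obj X ⟶ (t.ιHeart.obj Y)⟦n⟧) (hn : n < 0) : f = 0 := by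
  have : t.IsGE ((t.ιHeart.obj Y)⟦n⟧) (-n) := t.isGE_shift _ 0 n (-n)
  exact t.zero f 0 (-n)

lemma heart_hom_from_shift_eq_zero {X Y : M} {n : ℤ}
    (f : (t.ιHeart.obj X)⟦n⟧ ⟶ t.ιHeart.obj Y) (hn : 0 < n) : f = 0 :=
  AbelianSubcategory.eq_zero_of_hom_shift_pos (heart_hom_shift_neg_eq_zero t) f hn

lemma exists_iso_heart_obj (Y : D) (h₁ : t.IsLE Y 0) (h₂ : t.IsGE Y 0) :
    ∃ X : M, Nonempty (t.ιHeart.obj X ≅ Y) := by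
  have h : t.heart Y := (t.mem_heart_iff Y).2 ⟨h₁, h₂⟩
  rw [← t.essImage_ιHeart M] at h
  exact ⟨h.witness, ⟨h.getIso⟩⟩

/-- The cone of a morphism of the heart lives in degrees `-1` and `0`, so its truncation triangle
has the form `K[1] ⟶ cone ⟶ Q` with `K`, `Q` in the heart: the kernel and the cokernel. -/
lemma admissibleMorphism_heart_eq_top :
    AbelianSubcategory.admissibleMorphism (t.ιHeart (H := M)) = ⊤ := by
  refine le_antisymm le_top fun X₁ X₂ f₁ _ X₃ f₂ f₃ hT => ?_
  have hT' := rot_of_distTriang _ hT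
  have g1 : t.IsGE ((t.ιHeart.obj X₁)⟦(1 : ℤ)⟧) (-1) := t.isGE_shift _ 0 1 (-1)
  have l1 : t.IsLE ((t.ιHeart.obj X₁)⟦(1 : ℤ)⟧) 0 := by
    have := t.isLE_shift (t.ιHeart.obj X₁) 0 1 (-1)
    exact t.isLE_of_le _ (-1) 0
  have g3 : t.IsGE X₃ (-1) := t.isGE₂ _ hT' (-1) (t.isGE_of_ge (t.ιHeart.obj X₂) (-1) 0) g1
  have l3 : t.IsLE X₃ 0 := t.isLE₂ _ hT' 0 (inferInstanceAs (t.IsLE (t.ιHeart.obj X₂) 0)) l1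
  obtain ⟨X, Y, hX, hY, a, b, c, hd⟩ := t.exists_triangle X₃ (-1) 0 (by lia)
  have hX : t.IsLE X (-1) := ⟨hX⟩
  have hY : t.IsGE Y 0 := ⟨hY⟩
  have hYl : t.IsLE Y 0 := by
    have : t.IsLE (X⟦(1 : ℤ)⟧) 0 := by
      have := t.isLE_shift X (-1) 1 (-2)
      exact t.isLE_of_le _ (-2) 0
    exact t.isLE₂ _ (rot_of_distTriang _ hd) 0 l3 this
  have hXg : t.IsGE X (-1) := by
    have : t.IsGE (Y⟦(-1 : ℤ)⟧) (-1) := by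
      have := t.isGE_shift Y 0 (-1) 1
      exact t.isGE_of_ge _ (-1) 1
    exact t.isGE₂ _ (inv_rot_of_distTriang _ hd) (-1) this g3
  have hX1 : t.IsLE (X⟦(-1 : ℤ)⟧) 0 := t.isLE_shift X (-1) (-1) 0
  have hX2 : t.IsGE (X⟦(-1 : ℤ)⟧) 0 := t.isGE_shift X (-1) (-1) 0
  obtain ⟨K, ⟨eK⟩⟩ := exists_iso_heart_obj t (M := M) _ hX1 hX2
  obtain ⟨Q, ⟨eQ⟩⟩ := exists_iso_heart_obj t (M := M) _ hYl hY
  let e : (t.ιHeart.obj K)⟦(1 : ℤ)⟧ ≅ X :=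
    (shiftFunctor D (1 : ℤ)).mapIso eK ≪≫ (shiftEquiv D (1 : ℤ)).counitIso.app X
  refine ⟨K, Q, e.hom ≫ a, b ≫ eQ.inv, eQ.hom ≫ c ≫ e.inv⟦1⟧', ?_⟩
  refine distinguished_of_iso hd e (Iso.refl _) eQ ?_ ?_ ?_
  · simp
  · simp
  · simp [← Functor.map_comp]

/-- Short exact sequences of the heart extend to distinguished triangles. -/
lemma exists_distinguished_of_shortExact {S : ShortComplex M} (hS : S.ShortExact) :
    ∃ δ : t.ιHeart.obj S.X₃ ⟶ (t.ιHeart.obj S.X₁)⟦(1 : ℤ)⟧,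
      Triangle.mk (t.ιHeart.map S.f) (t.ιHeart.map S.g) δ ∈ distTriang D := by
  have := hS.epi_g
  have := hS.mono_f
  obtain ⟨X₁, i, δ, h⟩ := AbelianSubcategory.exists_distinguished_triangle_of_epi
    (heart_hom_shift_neg_eq_zero t) (admissibleMorphism_heart_eq_top t) S.g
  have hi := AbelianSubcategory.isLimitKernelForkOfDistTriang
    (heart_hom_shift_neg_eq_zero t) i S.g δ h
  let e : S.X₁ ≅ X₁ := hS.fIsKernel.conePointUniqueUpToIso hi
  have he : e.hom ≫ i = S.f := hS.fIsKernel.conePointUniqueUpToIso_hom_comp hi .zero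
  have he' : i = e.inv ≫ S.f := by rw [← he, e.inv_hom_id_assoc]
  refine ⟨δ ≫ (t.ιHeart.map e.inv)⟦1⟧', distinguished_of_iso h
    (t.ιHeart.mapIso e) (Iso.refl _) (Iso.refl _) ?_ ?_ ?_⟩
  · simp [he']
  · simp
  · simp [← Functor.map_comp]

/-- Distinguished triangles with vertices in the heart come from short exact sequences. -/
lemma shortExact_of_distinguished {S : ShortComplex M}
    (δ : t.ιHeart.obj S.X₃ ⟶ (t.ιHeart.obj S.X₁)⟦(1 : ℤ)⟧)
    (h : Triangle.mk (t.ιHeart.map S.f) (t.ιHeart.map S.g) δ ∈ distTriang D) :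
    S.ShortExact := by
  have hi := AbelianSubcategory.isLimitKernelForkOfDistTriang
    (heart_hom_shift_neg_eq_zero t) S.f S.g δ h
  have hp := AbelianSubcategory.isColimitCokernelCoforkOfDistTriang
    (heart_hom_shift_neg_eq_zero t) S.f S.g δ h
  have h₁ : Mono S.f := mono_of_isLimit_fork hi
  have h₂ : Epi S.g := epi_of_isColimit_cofork hp
  exact { exact := S.exact_of_f_is_kernel hi }

/-- The connecting morphism of a short exact sequence of the heart. -/
noncomputable def connecting {S : ShortComplex M} (hS : S.ShortExact) :
    t.ιHeart.obj S.X₃ ⟶ (t.ιHeart.obj S.X₁)⟦(1 : ℤ)⟧ :=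
  (exists_distinguished_of_shortExact t hS).choose

lemma connecting_distinguished {S : ShortComplex M} (hS : S.ShortExact) :
    Triangle.mk (t.ιHeart.map S.f) (t.ιHeart.map S.g) (connecting t hS) ∈ distTriang D :=
  (exists_distinguished_of_shortExact t hS).choose_spec

/-- Completing the square gives a morphism of triangles. Its third component must be `φ.τ₃`: the
difference factors through a map from `S.X₁[1]` to the heart, which is zero. -/
lemma distinguished_naturality {S S' : ShortComplex M} (φ : S ⟶ S')
    {δ : t.ιHeart.obj S.X₃ ⟶ (t.ιHeart.obj S.X₁)⟦(1 : ℤ)⟧}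
    (h : Triangle.mk (t.ιHeart.map S.f) (t.ιHeart.map S.g) δ ∈ distTriang D)
    {δ' : t.ιHeart.obj S'.X₃ ⟶ (t.ιHeart.obj S'.X₁)⟦(1 : ℤ)⟧}
    (h' : Triangle.mk (t.ιHeart.map S'.f) (t.ιHeart.map S'.g) δ' ∈ distTriang D) :
    δ ≫ (t.ιHeart.map φ.τ₁)⟦1⟧' = t.ιHeart.map φ.τ₃ ≫ δ' := by
  obtain ⟨c, hc, hc'⟩ := distinguished_complete₃ h h'
    (t.ιHeart.map φ.τ₁) (t.ιHeart.map φ.τ₂) (by simp only [← Functor.map_comp, φ.comm₁₂])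
  have : c = t.ιHeart.map φ.τ₃ := by
    rw [← sub_eq_zero]
    obtain ⟨k, hk⟩ := distinguished_yoneda₃ h (c - t.ιHeart.map φ.τ₃) (by
      rw [Preadditive.comp_sub, hc, ← Functor.map_comp, ← Functor.map_comp, φ.comm₂₃, sub_self])
    rw [hk, heart_hom_from_shift_eq_zero t k (by lia), comp_zero]
  rw [hc', this]

lemma connecting_naturality {S S' : ShortComplex M} (hS : S.ShortExact) (hS' : S'.ShortExact)
    (φ : S ⟶ S') :
    connecting t hS ≫ (t.ιHeart.map φ.τ₁)⟦1⟧' = t.ιHeart.map φ.τ₃ ≫ connecting t hS' :=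
  distinguished_naturality t φ (connecting_distinguished t hS) (connecting_distinguished t hS')

/-- Every morphism `A ⟶ B[1]` between objects of the heart is the connecting morphism of an
extension. -/
lemma exists_extension {A B : M} (e : t.ιHeart.obj A ⟶ (t.ιHeart.obj B)⟦(1 : ℤ)⟧) :
    ∃ (X : M) (f : B ⟶ X) (g : X ⟶ A),
      Triangle.mk (t.ιHeart.map f) (t.ιHeart.map g) e ∈ distTriang D := by
  obtain ⟨Z, f, g, h⟩ := distinguished_cocone_triangle₂ e
  have l : t.IsLE Z 0 := t.isLE₂ _ h 0 (inferInstanceAs (t.IsLE (t.ιHeart.obj B) 0))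
    (inferInstanceAs (t.IsLE (t.ιHeart.obj A) 0))
  have r : t.IsGE Z 0 := t.isGE₂ _ h 0 (inferInstanceAs (t.IsGE (t.ιHeart.obj B) 0))
    (inferInstanceAs (t.IsGE (t.ιHeart.obj A) 0))
  obtain ⟨X, ⟨i⟩⟩ := exists_iso_heart_obj t (M := M) Z l r
  refine ⟨X, t.ιHeart.preimage (f ≫ i.inv), t.ιHeart.preimage (i.hom ≫ g),
    distinguished_of_iso h (Iso.refl _) i (Iso.refl _) ?_ ?_ ?_⟩
  all_goals simp

/-- A morphism out of the subobject of a short exact sequence extends when the obstruction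
group vanishes. -/
lemma exists_extend_of_shortExact {S : ShortComplex M} (hS : S.ShortExact) {Y : M}
    (h0 : ∀ f : t.ιHeart.obj S.X₃ ⟶ (t.ιHeart.obj Y)⟦(1 : ℤ)⟧, f = 0) (g : S.X₁ ⟶ Y) :
    ∃ r : S.X₂ ⟶ Y, S.f ≫ r = g := by
  obtain ⟨r, hr⟩ := distinguished_yoneda₁ (connecting_distinguished t hS) (t.ιHeart.map g)
    (h0 _)
  exact ⟨t.ιHeart.preimage r, t.ιHeart.map_injective (by simpa using hr)⟩

end Heart

/-! ### Finite-length abelian categories -/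

section FiniteLength

variable {M : Type*} [Category* M] [Abelian M]

lemma shortExact_kernel {X Y : M} (p : X ⟶ Y) [Epi p] :
    (ShortComplex.mk (kernel.ι p) p (kernel.condition p)).ShortExact where
  exact := ShortComplex.exact_of_f_is_kernel _ (kernelIsKernel p)

lemma shortExact_cokernel {X Y : M} (i : X ⟶ Y) [Mono i] :
    (ShortComplex.mk i (cokernel.π i) (cokernel.condition i)).ShortExact where
  exact := ShortComplex.exact_of_g_is_cokernel _ (cokernelIsCokernel i)

lemma prop_of_kernel_of_target (P : ObjectProperty M) [P.IsSerreClass] {X Y : M} (f : X ⟶ Y)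
    (h₁ : P (kernel f)) (h₂ : P Y) : P X :=
  P.prop_X₂_of_exact (S := ShortComplex.mk (kernel.ι f) f (kernel.condition f))
    (ShortComplex.exact_of_f_is_kernel _ (kernelIsKernel f)) h₁ h₂

/-- The noetherian condition gives a maximal proper subobject, and the quotient by it is simple. -/
lemma exists_epi_simple {X : M} [IsNoetherianObject X] (hX : ¬ IsZero X) :
    ∃ (L : M) (p : X ⟶ L), Simple L ∧ Epi p := by
  have hne : (⊥ : Subobject X) ≠ ⊤ := by
    intro h
    apply hX
    have : IsIso ((⊥ : Subobject X).arrow) := by rw [h]; infer_instance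
    rw [Subobject.bot_arrow] at this
    exact IsZero.of_epi (X := ((⊥ : Subobject X) : M)) (f := 0)
      ((isZero_zero M).of_iso Subobject.botCoeIsoZero)
  obtain ⟨V, hV, -⟩ := (eq_top_or_exists_le_coatom (⊥ : Subobject X)).resolve_left hne
  refine ⟨cokernel V.arrow, cokernel.π V.arrow, ⟨fun {Y} f _ => ⟨fun hf h0 => ?_, fun hf => ?_⟩⟩,
    inferInstance⟩
  · subst h0
    have h1 : 𝟙 (cokernel V.arrow) = 0 := by
      rw [← cancel_epi (0 : Y ⟶ cokernel V.arrow)]; simp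
    have h2 : cokernel.π V.arrow = 0 := by rw [← Category.comp_id (cokernel.π _), h1, comp_zero]
    have h3 : Epi V.arrow := Preadditive.epi_of_cokernel_zero h2
    have h4 : IsIso V.arrow := isIso_of_mono_of_epi _
    exact hV.1 (Subobject.eq_top_of_isIso_arrow V)
  -- The preimage in `X` of the subobject `f` contains the coatom `V`, so it is `V`, forcing `f =
  -- 0`, or all of `X`, forcing `f` to be epi.
  · have hle : V ≤ Subobject.mk (pullback.snd f (cokernel.π V.arrow)) :=
      Subobject.le_mk_of_comm (pullback.lift 0 V.arrow (by rw [cokernel.condition, zero_comp]))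
        (pullback.lift_snd _ _ _)
    rcases hle.eq_or_lt with h | h
    · exfalso
      apply hf
      have hsnd : pullback.snd f (cokernel.π V.arrow) ≫ cokernel.π V.arrow = 0 := by
        have := Subobject.ofMkLE_arrow (f := pullback.snd f (cokernel.π V.arrow)) h.ge
        rw [← this, Category.assoc, cokernel.condition, comp_zero]
      rw [← cancel_epi (pullback.fst f (cokernel.π V.arrow)), comp_zero, pullback.condition, hsnd]
    · have htop := hV.2 _ h
      have : IsIso (pullback.snd f (cokernel.π V.arrow)) :=
        (Subobject.isIso_iff_mk_eq_top _).2 htop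
      have : Epi (pullback.fst f (cokernel.π V.arrow) ≫ f) := by
        rw [pullback.condition]; infer_instance
      have : Epi f := epi_of_epi (pullback.fst f (cokernel.π V.arrow)) f
      exact isIso_of_mono_of_epi f

/-- Induction on objects of finite length. -/
lemma finiteLength_induction (hfl : ∀ X : M, IsArtinianObject X ∧ IsNoetherianObject X)
    (P : ObjectProperty M) (zero : ∀ X, IsZero X → P X)
    (ext : ∀ S : ShortComplex M, S.ShortExact → Simple S.X₃ → P S.X₁ → P S.X₂) (X : M) : P X := by
  have := (hfl X).1
  -- The well-founded order is that of the subobjects of the fixed object `X`, so the claim is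
  -- proved for every object embedded in `X`.
  suffices ∀ (V : Subobject X) (Y : M) (i : Y ⟶ X) [Mono i], Subobject.mk i = V → P Y from
    this _ X (𝟙 X) rfl
  intro V
  induction V using WellFoundedLT.induction with
  | ind V ih =>
    rintro Y i _ rfl
    by_cases hY : IsZero Y
    · exact zero Y hY
    · have := (hfl Y).2
      obtain ⟨L, p, hL, hp⟩ := exists_epi_simple hY
      refine ext _ (shortExact_kernel p) hL (ih _ ?_ _ (kernel.ι p ≫ i) rfl)
      refine Subobject.mk_lt_mk_of_comm (kernel.ι p) rfl fun hiso => ?_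
      have h0 : p = 0 := by rw [← cancel_epi (kernel.ι p), kernel.condition, comp_zero]
      subst h0
      exact Simple.not_isZero L (IsZero.of_epi_zero Y L)

end FiniteLength

/-! ### Serre subcategories cut out by weights -/

section Weights

variable {M : Type*} [Category* M] [Abelian M]

instance serreGenerated_isSerreClass (P : ObjectProperty M) : (serreGenerated P).IsSerreClass where
  exists_zero := ⟨0, isZero_zero M, fun Q _ _ _ _ _ => Q.prop_zero⟩
  prop_of_mono f _ h := fun Q h₁ h₂ h₃ h₄ h₅ => Q.prop_of_mono f (h Q h₁ h₂ h₃ h₄ h₅)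
  prop_of_epi f _ h := fun Q h₁ h₂ h₃ h₄ h₅ => Q.prop_of_epi f (h Q h₁ h₂ h₃ h₄ h₅)
  prop_X₂_of_shortExact hS h h' := fun Q h₁ h₂ h₃ h₄ h₅ =>
    Q.prop_X₂_of_shortExact hS (h Q h₁ h₂ h₃ h₄ h₅) (h' Q h₁ h₂ h₃ h₄ h₅)

lemma le_serreGenerated (P : ObjectProperty M) : P ≤ serreGenerated P :=
  fun _ hX _ _ _ _ _ h => h _ hX

lemma serreGenerated_le {P Q : ObjectProperty M} [hQ : Q.IsSerreClass] (h : P ≤ Q) :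
    serreGenerated P ≤ Q :=
  fun _ hX => hX Q inferInstance inferInstance inferInstance inferInstance h

variable (wt : Irr M → ℤ)

instance (S : Set ℤ) : (weightPart wt S).IsSerreClass := serreGenerated_isSerreClass _

lemma weightPart_mono {S T : Set ℤ} (h : S ⊆ T) : weightPart wt S ≤ weightPart wt T :=
  serreGenerated_le fun _ ⟨hL, hw⟩ => le_serreGenerated _ _ ⟨hL, h hw⟩

lemma irrClass_eq_of_iso {L L' : M} (hL : Simple L) (hL' : Simple L') (e : L ≅ L') :
    irrClass L hL = irrClass L' hL' :=
  Quotient.sound ⟨ObjectProperty.isoMk _ e⟩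

/-- The objects all of whose simple subquotients have weight in `S`. -/
def subquotientWeights (S : Set ℤ) : ObjectProperty M := fun X =>
  ∀ ⦃V L : M⦄ (i : V ⟶ X) (p : V ⟶ L) (hL : Simple L), Mono i → Epi p →
    wt (irrClass L hL) ∈ S

instance (S : Set ℤ) : (subquotientWeights wt S).IsSerreClass where
  exists_zero := ⟨0, isZero_zero M, fun V L i p hL _ _ => by
    have hV : IsZero V := IsZero.of_mono i (isZero_zero M)
    exact (Simple.not_isZero L (IsZero.of_epi p hV)).elim⟩
  prop_of_mono f _ h := fun V L i p hL _ hp => h (i ≫ f) p hL inferInstance hp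
  prop_of_epi f _ h := fun V L i p hL _ hp =>
    h (pullback.snd i f) (pullback.fst i f ≫ p) hL inferInstance (epi_comp _ _)
  prop_X₂_of_shortExact {S} hS h₁ h₃ := fun V L i p hL hi hp => by
    have := hS.mono_f
    -- Restrict `p` to the intersection of `V` with `S.X₁`. If it is zero there, `L` is a quotient
    -- of the image of `V` in `S.X₃`; otherwise it is epi there, and `L` is a subquotient of `S.X₁`.
    by_cases h : pullback.fst i S.f ≫ p = 0
    · let e := Abelian.factorThruImage (i ≫ S.g)
      have hk : kernel.ι e ≫ p = 0 := by
        have h0 : (kernel.ι e ≫ i) ≫ S.g = 0 := by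
          have he : e ≫ Abelian.image.ι (i ≫ S.g) = i ≫ S.g := Abelian.image.fac _
          clear_value e
          rw [Category.assoc]
          calc kernel.ι e ≫ i ≫ S.g = kernel.ι e ≫ e ≫ Abelian.image.ι (i ≫ S.g) :=
                congrArg _ he.symm
            _ = 0 := by rw [kernel.condition_assoc, zero_comp]
        rw [← pullback.lift_fst (f := i) (g := S.f) (kernel.ι e) (hS.exact.lift _ h0)
          (by simp), Category.assoc, h, comp_zero]
      let q := (Abelian.epiDesc e p hk)
      have hq : e ≫ q = p := Abelian.comp_epiDesc _ _ _
      have : Epi q := by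
        have : Epi (e ≫ q) := by rw [hq]; exact hp
        exact epi_of_epi e q
      exact h₃ (Abelian.image.ι (i ≫ S.g)) q hL inferInstance this
    · exact h₁ (pullback.snd i S.f) (pullback.fst i S.f ≫ p) hL inferInstance
        (epi_of_nonzero_to_simple h)

/-- This makes the generated Serre subcategory computable: a simple subquotient of a simple object
is isomorphic to it, and the condition on subquotients is already a Serre class. -/
lemma weightPart_le_subquotientWeights (S : Set ℤ) :
    weightPart wt S ≤ subquotientWeights wt S := by
  refine serreGenerated_le ?_
  rintro L' ⟨hL', hw⟩ V L i p hL hi hp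
  have hp0 : p ≠ 0 := by
    rintro rfl
    exact Simple.not_isZero L (IsZero.of_epi_zero V L)
  have hi0 : i ≠ 0 := by
    rintro rfl
    exact hp0 ((IsZero.of_mono_zero V L').eq_of_src _ _)
  have := isIso_of_mono_of_nonzero hi0
  have hV : Simple V := Simple.of_iso (asIso i)
  have := isIso_of_epi_of_nonzero hp0
  rwa [irrClass_eq_of_iso hL hL' ((asIso p).symm ≪≫ asIso i)]

lemma weight_mem_of_weightPart {S : Set ℤ} {L : M} (hL : Simple L) (h : weightPart wt S L) :
    wt (irrClass L hL) ∈ S :=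
  weightPart_le_subquotientWeights wt S L h (𝟙 L) (𝟙 L) hL inferInstance inferInstance

lemma weightPart_of_simple {S : Set ℤ} {L : M} (hL : Simple L) (h : wt (irrClass L hL) ∈ S) :
    weightPart wt S L :=
  le_serreGenerated _ _ ⟨hL, h⟩

lemma isZero_of_weightPart_disjoint (hfl : ∀ X : M, IsArtinianObject X ∧ IsNoetherianObject X)
    {S T : Set ℤ} (hST : Disjoint S T) {X : M} (h₁ : weightPart wt S X)
    (h₂ : weightPart wt T X) : IsZero X := by
  by_contra hX
  have := (hfl X).2
  obtain ⟨L, p, hL, hp⟩ := exists_epi_simple hX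
  exact Set.disjoint_left.1 hST
    (weight_mem_of_weightPart wt hL ((weightPart wt S).prop_of_epi p h₁))
    (weight_mem_of_weightPart wt hL ((weightPart wt T).prop_of_epi p h₂))

/-- The image of `f` has weights both in `S` and in `T`, so it is zero. -/
lemma hom_eq_zero_of_weightPart_disjoint
    (hfl : ∀ X : M, IsArtinianObject X ∧ IsNoetherianObject X)
    {S T : Set ℤ} (hST : Disjoint S T) {X Y : M} (hX : weightPart wt S X)
    (hY : weightPart wt T Y) (f : X ⟶ Y) : f = 0 := by
  have h0 := isZero_of_weightPart_disjoint wt hfl hST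
    ((weightPart wt S).prop_of_epi (Abelian.factorThruImage f) hX)
    ((weightPart wt T).prop_of_mono (Abelian.image.ι f) hY)
  rw [← Abelian.image.fac f, h0.eq_of_tgt (Abelian.factorThruImage f) 0, zero_comp]

lemma exists_weightPart_Icc (hfl : ∀ X : M, IsArtinianObject X ∧ IsNoetherianObject X) (X : M) :
    ∃ a b : ℤ, weightPart wt (Set.Icc a b) X := by
  refine finiteLength_induction hfl (fun X => ∃ a b : ℤ, weightPart wt (Set.Icc a b) X)
    (fun X hX => ⟨0, 0, (weightPart wt _).prop_of_isZero hX⟩) ?_ X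
  rintro S hS hL ⟨a, b, h⟩
  refine ⟨min a (wt (irrClass _ hL)), max b (wt (irrClass _ hL)),
    (weightPart wt _).prop_X₂_of_shortExact hS (weightPart_mono wt ?_ _ h)
      (weightPart_of_simple wt hL ?_)⟩
  · exact Set.Icc_subset_Icc (min_le_left _ _) (le_max_left _ _)
  · exact ⟨min_le_right _ _, le_max_right _ _⟩

end Weights

/-! ### Vanishing of extensions, truncation by weight, semisimplicity -/

section Mixed

variable {D : Type*} [Category* D] [Preadditive D] [HasZeroObject D] [HasShift D ℤ]
  [∀ n : ℤ, (shiftFunctor D n).Additive] [Pretriangulated D] [IsTriangulated D]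
  {t : TStructure D} {M : Type*} [Category* M] [Abelian M] [t.Heart M]
  {wt : Irr M → ℤ}

/-- Dévissage in both variables reduces to simple objects, where mixedness with `i = 1` applies: `s
≤ r` is the same as `r > s - 1`. -/
lemma IsMixed.ext_eq_zero (hm : IsMixed t wt) {S T : Set ℤ} (hST : ∀ s ∈ S, ∀ r ∈ T, s ≤ r)
    {X Y : M} (hX : weightPart wt S X) (hY : weightPart wt T Y)
    (f : t.ιHeart.obj X ⟶ (t.ιHeart.obj Y)⟦(1 : ℤ)⟧) : f = 0 := by
  revert hX f
  refine finiteLength_induction hm.finiteLength (fun X => weightPart wt S X →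
    ∀ f : t.ιHeart.obj X ⟶ (t.ιHeart.obj Y)⟦(1 : ℤ)⟧, f = 0) ?_ ?_ X
  · intro X h0 _ f
    exact (t.ιHeart.map_isZero h0).eq_of_src _ _
  · intro C hC hL ih hX f
    obtain ⟨l, hl⟩ := distinguished_yoneda₂ (connecting_distinguished t hC) f
      (ih ((weightPart wt S).prop_X₁_of_shortExact hC hX) _)
    suffices l = 0 by rw [hl, this, comp_zero]
    have hLS := weight_mem_of_weightPart wt hL ((weightPart wt S).prop_X₃_of_shortExact hC hX)
    clear hl
    revert hY l
    refine finiteLength_induction hm.finiteLength (fun Y => weightPart wt T Y →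
      ∀ l : t.ιHeart.obj C.X₃ ⟶ (t.ιHeart.obj Y)⟦(1 : ℤ)⟧, l = 0) ?_ ?_ Y
    · intro Y h0 _ l
      exact ((shiftFunctor D (1 : ℤ)).map_isZero (t.ιHeart.map_isZero h0)).eq_of_tgt _ _
    · intro C' hC' hL' ih' hY l
      have hLT := weight_mem_of_weightPart wt hL' ((weightPart wt T).prop_X₃_of_shortExact hC' hY)
      obtain ⟨k, hk⟩ := distinguished_coyoneda₂_shift (connecting_distinguished t hC') l
        (hm.hom_eq_zero _ _ hL hL' 1 (by linarith [hST _ hLS _ hLT]) _)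
      rw [hk, ih' ((weightPart wt T).prop_X₁_of_shortExact hC' hY) k, zero_comp]

/-- Every object is an extension of an object of weights `> n` by an object of weights `≤ n`. -/
lemma IsMixed.exists_weight_truncation (hm : IsMixed t wt) (n : ℤ) (X : M) :
    ∃ (A : M) (i : A ⟶ X), Mono i ∧ weightPart wt (Set.Iic n) A ∧
      weightPart wt (Set.Ioi n) (cokernel i) := by
  refine finiteLength_induction hm.finiteLength (fun X => ∃ (A : M) (i : A ⟶ X), Mono i ∧
    weightPart wt (Set.Iic n) A ∧ weightPart wt (Set.Ioi n) (cokernel i)) ?_ ?_ X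
  · intro X hX
    refine ⟨X, 𝟙 X, inferInstance, (weightPart wt _).prop_of_isZero hX,
      (weightPart wt _).prop_of_isZero (IsZero.of_epi (cokernel.π (𝟙 X)) hX)⟩
  · rintro S hS hL ⟨A, i, hi, hA, hB⟩
    have := hS.mono_f
    have := hS.epi_g
    by_cases hw : wt (irrClass _ hL) ≤ n
    -- When the top quotient `S.X₃` has weight `≤ n`, it has no extensions by the part `cokernel i`
    -- of weights `> n`. The projection of `S.X₁` onto that part thus extends to `S.X₂`, and the
    -- kernel of the extension is the new subobject: an extension of a part of `S.X₃` by a subobject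
    -- of `A`.
    · obtain ⟨r, hr⟩ := exists_extend_of_shortExact t hS
        (fun f => hm.ext_eq_zero (S := Set.Iic n) (T := Set.Ioi n)
          (fun s hs r hr => le_of_lt (lt_of_le_of_lt hs hr))
          (weightPart_of_simple wt hL hw) hB f) (cokernel.π i)
      have hre : Epi r := by
        have : Epi (S.f ≫ r) := by rw [hr]; infer_instance
        exact epi_of_epi S.f r
      refine ⟨kernel r, kernel.ι r, inferInstance, ?_, ?_⟩
      · refine prop_of_kernel_of_target _ (kernel.ι r ≫ S.g) ?_ (weightPart_of_simple wt hL hw)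
        let u : kernel (kernel.ι r ≫ S.g) ⟶ S.X₁ :=
          hS.exact.lift (kernel.ι (kernel.ι r ≫ S.g) ≫ kernel.ι r)
            (by rw [Category.assoc, kernel.condition])
        have hu : u ≫ S.f = kernel.ι (kernel.ι r ≫ S.g) ≫ kernel.ι r := hS.exact.lift_f _ _
        have hu' : u ≫ cokernel.π i = 0 := by
          rw [← hr, reassoc_of% hu, kernel.condition, comp_zero]
        let v := (shortExact_cokernel i).exact.lift u hu'
        have hv : v ≫ i = u := (shortExact_cokernel i).exact.lift_f u hu'
        have : Mono v := by
          have : Mono (v ≫ i ≫ S.f) := by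
            rw [reassoc_of% hv, hu]; infer_instance
          exact mono_of_mono v (i ≫ S.f)
        exact (weightPart wt _).prop_of_mono v hA
      · let e : cokernel (kernel.ι r) ≅ cokernel i :=
          (cokernelIsCokernel (kernel.ι r)).coconePointUniqueUpToIso
            (shortExact_kernel r).gIsCokernel
        exact (weightPart wt _).prop_of_iso e.symm hB
    -- When the top quotient has weight `> n`, the subobject `A` is unchanged and `S.X₃` joins the
    -- quotient.
    · refine ⟨A, i ≫ S.f, inferInstance, hA, ?_⟩
      let q : cokernel (i ≫ S.f) ⟶ S.X₃ := cokernel.desc _ S.g (by simp)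
      have hq : cokernel.π (i ≫ S.f) ≫ q = S.g := cokernel.π_desc _ _ _
      let j : cokernel i ⟶ cokernel (i ≫ S.f) :=
        cokernel.desc _ (S.f ≫ cokernel.π _) (by rw [← Category.assoc, cokernel.condition])
      have hj : cokernel.π i ≫ j = S.f ≫ cokernel.π (i ≫ S.f) := cokernel.π_desc _ _ _
      have w : j ≫ q = 0 := by
        rw [← cancel_epi (cokernel.π i), reassoc_of% hj, hq, S.zero, comp_zero]
      have hex : (ShortComplex.mk j q w).Exact := by
        refine ShortComplex.exact_of_g_is_cokernel _ ?_
        refine CokernelCofork.IsColimit.ofπ' _ _ fun {Z} k hk => ?_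
        have hk' : S.f ≫ cokernel.π (i ≫ S.f) ≫ k = 0 := by
          rw [← reassoc_of% hj, hk, comp_zero]
        refine ⟨hS.exact.desc (cokernel.π (i ≫ S.f) ≫ k) hk', ?_⟩
        rw [← cancel_epi (cokernel.π (i ≫ S.f)), reassoc_of% hq]
        exact hS.exact.g_desc _ _
      exact (weightPart wt _).prop_X₂_of_exact hex hB
        (weightPart_of_simple wt hL (not_le.1 hw))

/-- Objects of the same weight have no nontrivial extensions, so the identity of `S.X₁` extends to
`S.X₂`. -/
lemma IsMixed.exists_retraction (hm : IsMixed t wt) {n : ℤ} {S : ShortComplex M}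
    (hS : S.ShortExact) (h : weightPart wt {n} S.X₂) : ∃ r : S.X₂ ⟶ S.X₁, S.f ≫ r = 𝟙 S.X₁ :=
  exists_extend_of_shortExact t hS (fun f => hm.ext_eq_zero (S := {n}) (T := {n})
    (by rintro _ rfl _ rfl; exact le_rfl) ((weightPart wt _).prop_X₃_of_shortExact hS h)
    ((weightPart wt _).prop_X₁_of_shortExact hS h) f) _

lemma IsMixed.nonempty_splitting (hm : IsMixed t wt) {n : ℤ} {S : ShortComplex M}
    (hS : S.ShortExact) (h : weightPart wt {n} S.X₂) : Nonempty S.Splitting := by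
  obtain ⟨r, hr⟩ := hm.exists_retraction hS h
  have := hS.epi_g
  exact ⟨ShortComplex.Splitting.ofExactOfRetraction S hS.exact r hr inferInstance⟩

/-- Objects of a single weight are finite direct sums of simple objects. -/
lemma IsMixed.exists_decomposition (hm : IsMixed t wt) {n : ℤ} {X : M}
    (hX : weightPart wt {n} X) :
    ∃ (k : ℕ) (L : Fin k → M) (π : ∀ j, X ⟶ L j) (ι : ∀ j, L j ⟶ X),
      (∀ j, ∃ hL : Simple (L j), wt (irrClass (L j) hL) = n) ∧ (∀ j, ι j ≫ π j = 𝟙 _) ∧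
      (∀ i j, i ≠ j → ι i ≫ π j = 0) ∧ ∑ j, π j ≫ ι j = 𝟙 X := by
  revert hX
  refine finiteLength_induction hm.finiteLength (fun X => weightPart wt {n} X →
    ∃ (k : ℕ) (L : Fin k → M) (π : ∀ j, X ⟶ L j) (ι : ∀ j, L j ⟶ X),
      (∀ j, ∃ hL : Simple (L j), wt (irrClass (L j) hL) = n) ∧ (∀ j, ι j ≫ π j = 𝟙 _) ∧
      (∀ i j, i ≠ j → ι i ≫ π j = 0) ∧ ∑ j, π j ≫ ι j = 𝟙 X) ?_ ?_ X
  · intro X h0 _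
    exact ⟨0, Fin.elim0, fun j => j.elim0, fun j => j.elim0, fun j => j.elim0, fun j => j.elim0,
      fun j => j.elim0, h0.eq_of_src _ _⟩
  · intro S hS hL ih hX
    obtain ⟨k, L, π, ι, h₁, h₂, h₃, h₄⟩ := ih ((weightPart wt _).prop_X₁_of_shortExact hS hX)
    obtain ⟨σ⟩ := hm.nonempty_splitting hS hX
    have hw : wt (irrClass _ hL) = n :=
      weight_mem_of_weightPart wt hL ((weightPart wt _).prop_X₃_of_shortExact hS hX)
    have hsr : σ.s ≫ σ.r = 0 := σ.s_r
    have h₅ : σ.r ≫ (∑ j, π j ≫ ι j) ≫ S.f = σ.r ≫ S.f := by rw [h₄, Category.id_comp]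
    refine ⟨k + 1, Fin.cons S.X₃ L, Fin.cons S.g fun j => σ.r ≫ π j,
      Fin.cons σ.s fun j => ι j ≫ S.f, Fin.cases ⟨hL, hw⟩ h₁, ?_, ?_, ?_⟩
    · refine Fin.cases σ.s_g fun j => ?_
      change (ι j ≫ S.f) ≫ σ.r ≫ π j = 𝟙 (L j)
      simp [h₂ j]
    · refine Fin.cases (Fin.cases (fun h => (h rfl).elim) fun j _ => ?_)
        fun i => Fin.cases (fun _ => ?_) fun j hij => ?_
      · change σ.s ≫ σ.r ≫ π j = 0
        simp [reassoc_of% hsr]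
      · change (ι i ≫ S.f) ≫ S.g = 0
        simp
      · change (ι i ≫ S.f) ≫ σ.r ≫ π j = 0
        simpa using h₃ i j fun h => hij (congrArg Fin.succ h)
    · refine (Fin.sum_univ_succ _).trans ?_
      change S.g ≫ σ.s + ∑ j, (σ.r ≫ π j) ≫ (ι j ≫ S.f) = 𝟙 _
      simp only [Preadditive.sum_comp, Preadditive.comp_sum, Category.assoc] at h₅ ⊢
      rw [h₅, add_comm]
      exact σ.id

end Mixed

/-- The hypothesis `h` says that `A` is the full preimage of `A'` under `q`, in terms of generalised
elements. -/
lemma mono_cokernel_map {M : Type*} [Category* M] [Abelian M] {A B A' B' : M} (a : A ⟶ B)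
    (a' : A' ⟶ B') (p : A ⟶ A') (q : B ⟶ B') (w : a ≫ q = p ≫ a')
    (h : ∀ ⦃T : M⦄ (x : T ⟶ B) (y : T ⟶ A'), x ≫ q = y ≫ a' → ∃ z : T ⟶ A, z ≫ a = x) :
    Mono (cokernel.map a a' p q w) := by
  rw [Preadditive.mono_iff_cancel_zero]
  intro T g hg
  obtain ⟨T', π, hπ, x, hx⟩ := surjective_up_to_refinements_of_epi (cokernel.π a) g
  have h₁ : (x ≫ q) ≫ cokernel.π a' = 0 := by
    rw [Category.assoc, ← cokernel.π_desc a (q ≫ cokernel.π a') (by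
      rw [reassoc_of% w, cokernel.condition, comp_zero]), ← reassoc_of% hx]
    exact (congrArg (π ≫ ·) hg).trans comp_zero
  have hex : (ShortComplex.mk a' (cokernel.π a') (cokernel.condition a')).Exact :=
    ShortComplex.exact_of_g_is_cokernel _ (cokernelIsCokernel a')
  obtain ⟨T'', π', hπ', y, hy⟩ := hex.exact_up_to_refinements (x ≫ q) h₁
  obtain ⟨z, hz⟩ := h (π' ≫ x) y (by simpa using hy)
  rw [← cancel_epi π, ← cancel_epi π', hx, ← reassoc_of% hz, cokernel.condition]
  simp

/-! ### The weight filtration and its graded pieces -/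

section Filtration

variable {D : Type*} [Category* D] [Preadditive D] [HasZeroObject D] [HasShift D ℤ]
  [∀ n : ℤ, (shiftFunctor D n).Additive] [Pretriangulated D] [IsTriangulated D]
  {t : TStructure D} {M : Type*} [Category* M] [Abelian M] [t.Heart M]
  {wt : Irr M → ℤ}

lemma subquotientWeights_le_weightPart (hfl : ∀ X : M, IsArtinianObject X ∧ IsNoetherianObject X)
    (S : Set ℤ) : subquotientWeights wt S ≤ weightPart wt S := by
  intro X
  refine finiteLength_induction hfl (fun X => subquotientWeights wt S X → weightPart wt S X)
    (fun X hX _ => (weightPart wt S).prop_of_isZero hX) (fun C hC hL ih h => ?_) X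
  have := hC.epi_g
  exact (weightPart wt S).prop_X₂_of_shortExact hC
    (ih ((subquotientWeights wt S).prop_X₁_of_shortExact hC h))
    (weightPart_of_simple wt hL (h (𝟙 _) C.g hL inferInstance inferInstance))

lemma weightPart_inter (hfl : ∀ X : M, IsArtinianObject X ∧ IsNoetherianObject X)
    {S T : Set ℤ} {X : M} (hS : weightPart wt S X) (hT : weightPart wt T X) :
    weightPart wt (S ∩ T) X :=
  subquotientWeights_le_weightPart hfl _ _ fun _ _ i p hL hi hp =>
    ⟨weightPart_le_subquotientWeights wt S X hS i p hL hi hp,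
      weightPart_le_subquotientWeights wt T X hT i p hL hi hp⟩

namespace IsMixed

variable (hm : IsMixed t wt)

/-- The largest subobject with weights `≤ -i`. -/
noncomputable def filObj (i : ℤ) (X : M) : M := (hm.exists_weight_truncation (-i) X).choose

noncomputable def filι (i : ℤ) (X : M) : hm.filObj i X ⟶ X :=
  (hm.exists_weight_truncation (-i) X).choose_spec.choose

instance (i : ℤ) (X : M) : Mono (hm.filι i X) :=
  (hm.exists_weight_truncation (-i) X).choose_spec.choose_spec.1

lemma weightPart_filObj (i : ℤ) (X : M) : weightPart wt (Set.Iic (-i)) (hm.filObj i X) :=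
  (hm.exists_weight_truncation (-i) X).choose_spec.choose_spec.2.1

lemma weightPart_cokernel_filι (i : ℤ) (X : M) :
    weightPart wt (Set.Ioi (-i)) (cokernel (hm.filι i X)) :=
  (hm.exists_weight_truncation (-i) X).choose_spec.choose_spec.2.2

/-- The composite to `X / F i X` goes from weights `≤ -i` to weights `> -i`, so it vanishes. This
universal property makes the filtration functorial. -/
lemma exists_filLift {i : ℤ} {A X : M} (hA : weightPart wt (Set.Iic (-i)) A) (f : A ⟶ X) :
    ∃ l : A ⟶ hm.filObj i X, l ≫ hm.filι i X = f := by
  have h0 := hom_eq_zero_of_weightPart_disjoint wt hm.finiteLength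
    (Set.Iic_disjoint_Ioi le_rfl) hA (hm.weightPart_cokernel_filι i X) (f ≫ cokernel.π _)
  exact ⟨_, (shortExact_cokernel (hm.filι i X)).exact.lift_f f h0⟩

noncomputable def filLift {i : ℤ} {A X : M} (hA : weightPart wt (Set.Iic (-i)) A) (f : A ⟶ X) :
    A ⟶ hm.filObj i X :=
  (hm.exists_filLift hA f).choose

@[simp]
lemma filLift_filι {i : ℤ} {A X : M} (hA : weightPart wt (Set.Iic (-i)) A) (f : A ⟶ X) :
    hm.filLift hA f ≫ hm.filι i X = f :=
  (hm.exists_filLift hA f).choose_spec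

noncomputable def filMap (i : ℤ) {X Y : M} (f : X ⟶ Y) : hm.filObj i X ⟶ hm.filObj i Y :=
  hm.filLift (hm.weightPart_filObj i X) (hm.filι i X ≫ f)

@[simp]
lemma filMap_filι (i : ℤ) {X Y : M} (f : X ⟶ Y) :
    hm.filMap i f ≫ hm.filι i Y = hm.filι i X ≫ f :=
  hm.filLift_filι _ _

@[simp]
lemma filMap_filι_assoc (i : ℤ) {X Y Z : M} (f : X ⟶ Y) (g : Y ⟶ Z) :
    hm.filMap i f ≫ hm.filι i Y ≫ g = hm.filι i X ≫ f ≫ g := by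
  rw [← Category.assoc, filMap_filι, Category.assoc]

/-- The inclusion of a step of the weight filtration into the next one. -/
noncomputable def filIncl (i : ℤ) (X : M) : hm.filObj (i + 1) X ⟶ hm.filObj i X :=
  hm.filLift (weightPart_mono wt (Set.Iic_subset_Iic.2 (by lia)) _
    (hm.weightPart_filObj (i + 1) X)) (hm.filι (i + 1) X)

@[simp]
lemma filIncl_filι (i : ℤ) (X : M) : hm.filIncl i X ≫ hm.filι i X = hm.filι (i + 1) X :=
  hm.filLift_filι _ _

@[simp]
lemma filIncl_filι_assoc (i : ℤ) {X Z : M} (g : X ⟶ Z) :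
    hm.filIncl i X ≫ hm.filι i X ≫ g = hm.filι (i + 1) X ≫ g := by
  rw [← Category.assoc, filIncl_filι]

instance (i : ℤ) (X : M) : Mono (hm.filIncl i X) :=
  mono_of_mono_fac (hm.filIncl_filι i X)

lemma filIncl_filMap (i : ℤ) {X Y : M} (f : X ⟶ Y) :
    hm.filIncl i X ≫ hm.filMap i f = hm.filMap (i + 1) f ≫ hm.filIncl i Y := by
  simp [← cancel_mono (hm.filι i Y)]

lemma filIncl_filMap_assoc (i : ℤ) {X Y Z : M} (f : X ⟶ Y) (g : hm.filObj i Y ⟶ Z) :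
    hm.filIncl i X ≫ hm.filMap i f ≫ g = hm.filMap (i + 1) f ≫ hm.filIncl i Y ≫ g := by
  rw [← Category.assoc, filIncl_filMap, Category.assoc]

/-- The graded pieces of the weight filtration. -/
noncomputable def grObj (i : ℤ) (X : M) : M := cokernel (hm.filIncl i X)

noncomputable def grπ (i : ℤ) (X : M) : hm.filObj i X ⟶ hm.grObj i X := cokernel.π _

instance (i : ℤ) (X : M) : Epi (hm.grπ i X) := inferInstanceAs (Epi (cokernel.π _))

@[simp]
lemma filIncl_grπ (i : ℤ) (X : M) : hm.filIncl i X ≫ hm.grπ i X = 0 := cokernel.condition _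

noncomputable def grMap (i : ℤ) {X Y : M} (f : X ⟶ Y) : hm.grObj i X ⟶ hm.grObj i Y :=
  cokernel.map _ _ (hm.filMap (i + 1) f) (hm.filMap i f) (hm.filIncl_filMap i f)

@[simp]
lemma grπ_grMap (i : ℤ) {X Y : M} (f : X ⟶ Y) :
    hm.grπ i X ≫ hm.grMap i f = hm.filMap i f ≫ hm.grπ i Y :=
  cokernel.π_desc _ _ _

@[simp]
lemma grπ_grMap_assoc (i : ℤ) {X Y Z : M} (f : X ⟶ Y) (g : hm.grObj i Y ⟶ Z) :
    hm.grπ i X ≫ hm.grMap i f ≫ g = hm.filMap i f ≫ hm.grπ i Y ≫ g := by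
  rw [← Category.assoc, grπ_grMap, Category.assoc]

/-- The short complex `F (i + 1) X ⟶ F i X ⟶ gr i X`. -/
noncomputable abbrev filComplex (i : ℤ) (X : M) : ShortComplex M :=
  ShortComplex.mk (hm.filIncl i X) (hm.grπ i X) (hm.filIncl_grπ i X)

lemma filComplex_shortExact (i : ℤ) (X : M) : (hm.filComplex i X).ShortExact :=
  shortExact_cokernel (hm.filIncl i X)

/-- As a quotient of `F i X` the piece has weights `≤ -i`; as a subobject of `X / F (i + 1) X` it
has weights `> -(i + 1)`. -/
lemma weightPart_grObj (i : ℤ) (X : M) : weightPart wt {-i} (hm.grObj i X) := by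
  have h₁ : weightPart wt (Set.Iic (-i)) (hm.grObj i X) :=
    (weightPart wt _).prop_of_epi (hm.grπ i X) (hm.weightPart_filObj i X)
  have hmono := mono_cokernel_map (hm.filIncl i X) (hm.filι (i + 1) X) (𝟙 _) (hm.filι i X)
    (by simp) (fun T x y hxy => ⟨y, by simp [← cancel_mono (hm.filι i X), hxy]⟩)
  have h₂ : weightPart wt (Set.Ioi (-(i + 1))) (hm.grObj i X) :=
    @ObjectProperty.prop_of_mono _ _ (weightPart wt _) _ _ _ _ hmono
      (hm.weightPart_cokernel_filι (i + 1) X)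
  refine weightPart_mono wt ?_ _ (weightPart_inter hm.finiteLength h₁ h₂)
  rintro k ⟨hk₁, hk₂⟩
  simp only [Set.mem_Iic, Set.mem_Ioi, Set.mem_singleton_iff] at *
  lia

lemma grMap_id (i : ℤ) (X : M) : hm.grMap i (𝟙 X) = 𝟙 _ := by
  rw [← cancel_epi (hm.grπ i X), grπ_grMap, Category.comp_id]
  convert Category.id_comp _
  simp [← cancel_mono (hm.filι i X)]

lemma filMap_comp (i : ℤ) {X Y Z : M} (f : X ⟶ Y) (g : Y ⟶ Z) :
    hm.filMap i (f ≫ g) = hm.filMap i f ≫ hm.filMap i g := by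
  simp [← cancel_mono (hm.filι i Z)]

lemma grMap_comp (i : ℤ) {X Y Z : M} (f : X ⟶ Y) (g : Y ⟶ Z) :
    hm.grMap i (f ≫ g) = hm.grMap i f ≫ hm.grMap i g := by
  simp [← cancel_epi (hm.grπ i X), filMap_comp]

lemma grMap_add (i : ℤ) {X Y : M} (f g : X ⟶ Y) :
    hm.grMap i (f + g) = hm.grMap i f + hm.grMap i g := by
  have : hm.filMap i (f + g) = hm.filMap i f + hm.filMap i g := by
    simp [← cancel_mono (hm.filι i Y)]
  simp [← cancel_epi (hm.grπ i X), this]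

lemma grMap_smul {F : Type*} [Ring F] [Linear F M] (i : ℤ) {X Y : M} (r : F) (f : X ⟶ Y) :
    hm.grMap i (r • f) = r • hm.grMap i f := by
  have : hm.filMap i (r • f) = r • hm.filMap i f := by
    simp [← cancel_mono (hm.filι i Y)]
  simp [← cancel_epi (hm.grπ i X), this]

lemma grMap_zero (i : ℤ) (X Y : M) : hm.grMap i (0 : X ⟶ Y) = 0 := by
  simpa using hm.grMap_add i (0 : X ⟶ Y) 0

/-- For a monomorphism, the weight filtration of the source is the induced one. -/
lemma exists_fil_lift_of_mono (i : ℤ) {X Y T : M} (f : X ⟶ Y) [Mono f] (x : T ⟶ X)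
    (y : T ⟶ hm.filObj i Y) (h : x ≫ f = y ≫ hm.filι i Y) :
    ∃ z : T ⟶ hm.filObj i X, z ≫ hm.filι i X = x := by
  refine ⟨pullback.lift x y h ≫ hm.filLift ((weightPart wt _).prop_of_mono
    (pullback.snd f (hm.filι i Y)) (hm.weightPart_filObj i Y)) (pullback.fst _ _), ?_⟩
  rw [Category.assoc, filLift_filι, pullback.lift_fst]

/-- The cokernel is a quotient of `F i Y`, of weights `≤ -i`. It also embeds in `Y / f (F i X)`, a
quotient of `X / F i X`, of weights `> -i`. Hence it is zero. -/
lemma epi_filMap (i : ℤ) {X Y : M} (f : X ⟶ Y) [Epi f] : Epi (hm.filMap i f) := by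
  apply Preadditive.epi_of_cokernel_zero
  have h₁ : weightPart wt (Set.Iic (-i)) (cokernel (hm.filMap i f)) :=
    (weightPart wt _).prop_of_epi (cokernel.π _) (hm.weightPart_filObj i Y)
  have hmono := mono_cokernel_map (hm.filMap i f) (hm.filι i X ≫ f) (𝟙 _) (hm.filι i Y)
    (by simp) (fun T x y hxy => ⟨y, by simpa [← cancel_mono (hm.filι i Y)] using hxy.symm⟩)
  let q : cokernel (hm.filι i X) ⟶ cokernel (hm.filι i X ≫ f) :=
    cokernel.map _ _ (𝟙 _) f (by simp)
  have hq : cokernel.π _ ≫ q = f ≫ cokernel.π _ := cokernel.π_desc _ _ _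
  have : Epi q := by
    have : Epi (cokernel.π (hm.filι i X) ≫ q) := by rw [hq]; infer_instance
    exact epi_of_epi (cokernel.π (hm.filι i X)) q
  have h₂ : weightPart wt (Set.Ioi (-i)) (cokernel (hm.filMap i f)) :=
    @ObjectProperty.prop_of_mono _ _ (weightPart wt _) _ _ _ _ hmono
      ((weightPart wt _).prop_of_epi q (hm.weightPart_cokernel_filι i X))
  exact (isZero_of_weightPart_disjoint wt hm.finiteLength (Set.Iic_disjoint_Ioi le_rfl)
    h₁ h₂).eq_of_tgt _ _

lemma mono_grMap (i : ℤ) {X Y : M} (f : X ⟶ Y) [Mono f] : Mono (hm.grMap i f) := by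
  refine mono_cokernel_map _ _ _ _ (hm.filIncl_filMap i f) fun T x y hxy => ?_
  obtain ⟨z, hz⟩ := hm.exists_fil_lift_of_mono (i + 1) f (x ≫ hm.filι i X) y (by
    have := congrArg (· ≫ hm.filι i Y) hxy
    simpa using this)
  exact ⟨z, by simpa [← cancel_mono (hm.filι i X)] using hz⟩

lemma epi_grMap (i : ℤ) {X Y : M} (f : X ⟶ Y) [Epi f] : Epi (hm.grMap i f) := by
  have := hm.epi_filMap i f
  have : Epi (hm.grπ i X ≫ hm.grMap i f) := by rw [grπ_grMap]; infer_instance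
  exact epi_of_epi (hm.grπ i X) _

/-- The functor `gr i` is exact. -/
lemma grMap_shortExact (i : ℤ) {S : ShortComplex M} (hS : S.ShortExact) :
    (ShortComplex.mk (hm.grMap i S.f) (hm.grMap i S.g)
      (by rw [← grMap_comp, S.zero, grMap_zero])).ShortExact := by
  have := hS.mono_f
  have := hS.epi_g
  have := hm.mono_grMap i S.f
  have := hm.epi_grMap i S.g
  refine { exact := ?_ }
  rw [ShortComplex.exact_iff_exact_up_to_refinements]
  intro T x hx
  dsimp at x hx ⊢
  obtain ⟨T₁, π₁, hπ₁, y, hy⟩ := surjective_up_to_refinements_of_epi (hm.grπ i S.X₂) x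
  have h₁ : (y ≫ hm.filMap i S.g) ≫ hm.grπ i S.X₃ = 0 := by
    rw [Category.assoc, ← grπ_grMap, ← reassoc_of% hy, hx, comp_zero]
  let u := (hm.filComplex_shortExact i S.X₃).exact.lift (y ≫ hm.filMap i S.g) h₁
  have hu : u ≫ hm.filIncl i S.X₃ = y ≫ hm.filMap i S.g :=
    (hm.filComplex_shortExact i S.X₃).exact.lift_f _ _
  have := hm.epi_filMap (i + 1) S.g
  obtain ⟨T₂, π₂, hπ₂, z, hz⟩ := surjective_up_to_refinements_of_epi (hm.filMap (i + 1) S.g) u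
  -- A lift `y` of `x` to `F i S.X₂` is corrected by an element of `F (i + 1) S.X₂` so that it dies
  -- in `S.X₃`. It then comes from `S.X₁`, and from `F i S.X₁` because the filtration there is the
  -- induced one.
  have h₂ : (π₂ ≫ y - z ≫ hm.filIncl i S.X₂) ≫ hm.filι i S.X₂ ≫ S.g = 0 := by
    rw [← filMap_filι, Preadditive.sub_comp, sub_eq_zero, Category.assoc, Category.assoc,
      filIncl_filMap_assoc, ← reassoc_of% hz, ← reassoc_of% hu]
  let v := hS.exact.lift ((π₂ ≫ y - z ≫ hm.filIncl i S.X₂) ≫ hm.filι i S.X₂) (by simpa using h₂)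
  have hv : v ≫ S.f = (π₂ ≫ y - z ≫ hm.filIncl i S.X₂) ≫ hm.filι i S.X₂ := hS.exact.lift_f _ _
  obtain ⟨s, hs⟩ := hm.exists_fil_lift_of_mono i S.f v _ hv
  have hs' : s ≫ hm.filMap i S.f = π₂ ≫ y - z ≫ hm.filIncl i S.X₂ := by
    rw [← cancel_mono (hm.filι i S.X₂), Category.assoc, filMap_filι, reassoc_of% hs, hv]
  refine ⟨T₂, π₂ ≫ π₁, epi_comp _ _, s ≫ hm.grπ i S.X₁, ?_⟩
  rw [Category.assoc, Category.assoc, grπ_grMap, reassoc_of% hs', hy]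
  simp

lemma isIso_filι (i : ℤ) {X : M} (h : weightPart wt (Set.Iic (-i)) X) : IsIso (hm.filι i X) :=
  have : Epi (hm.filι i X) := by
    have : Epi (hm.filLift h (𝟙 X) ≫ hm.filι i X) := by rw [filLift_filι]; infer_instance
    exact epi_of_epi (hm.filLift h (𝟙 X)) _
  isIso_of_mono_of_epi _

lemma isZero_filObj (i : ℤ) {X : M} (h : weightPart wt (Set.Ioi (-i)) X) :
    IsZero (hm.filObj i X) :=
  isZero_of_weightPart_disjoint wt hm.finiteLength (Set.Iic_disjoint_Ioi le_rfl)
    (hm.weightPart_filObj i X) ((weightPart wt _).prop_of_mono (hm.filι i X) h)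

lemma isIso_grπ (i : ℤ) {X : M} (h : IsZero (hm.filObj (i + 1) X)) : IsIso (hm.grπ i X) := by
  have h0 : hm.filIncl i X = 0 := h.eq_of_src _ _
  have : Mono (hm.grπ i X) := by
    rw [Preadditive.mono_iff_cancel_zero]
    intro T g hg
    obtain ⟨l, hl⟩ : ∃ l, l ≫ hm.filIncl i X = g :=
      ⟨_, (hm.filComplex_shortExact i X).exact.lift_f g hg⟩
    rw [← hl, h0, comp_zero]
  exact isIso_of_mono_of_epi _

lemma weightPart_grObj_of_weightPart (i : ℤ) {S : Set ℤ} {X : M} (h : weightPart wt S X) :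
    weightPart wt S (hm.grObj i X) :=
  (weightPart wt S).prop_of_epi (hm.grπ i X) ((weightPart wt S).prop_of_mono (hm.filι i X) h)

lemma isZero_grObj {i : ℤ} {S : Set ℤ} {X : M} (h : weightPart wt S X) (hi : -i ∉ S) :
    IsZero (hm.grObj i X) :=
  isZero_of_weightPart_disjoint wt hm.finiteLength (Set.disjoint_singleton_right.2 hi)
    (hm.weightPart_grObj_of_weightPart i h) (hm.weightPart_grObj i X)

/-- An object of weight `-i` is isomorphic to its only graded piece. -/
noncomputable def grIso {i : ℤ} {X : M} (h : weightPart wt {-i} X) : hm.grObj i X ≅ X :=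
  have := hm.isIso_filι i (weightPart_mono wt (by simp) _ h : weightPart wt (Set.Iic (-i)) X)
  have := hm.isIso_grπ i (hm.isZero_filObj (i + 1)
    (weightPart_mono wt (by simp) _ h : weightPart wt (Set.Ioi (-(i + 1))) X))
  (asIso (hm.grπ i X)).symm ≪≫ asIso (hm.filι i X)

/-- A simple subquotient of weight `w` survives, since `gr (-w)` preserves monomorphisms and
epimorphisms, as a nonzero subquotient of `gr (-w) X`. -/
lemma weightPart_iff_isZero_grObj (S : Set ℤ) (X : M) :
    weightPart wt S X ↔ ∀ i, -i ∉ S → IsZero (hm.grObj i X) := by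
  refine ⟨fun h i hi => hm.isZero_grObj h hi, fun h =>
    subquotientWeights_le_weightPart hm.finiteLength _ _ fun V L j p hL hj hp => ?_⟩
  by_contra hw
  let i := -wt (irrClass L hL)
  have h₁ := h i (by simpa [i] using hw)
  have := hm.mono_grMap i j
  have := hm.epi_grMap i p
  have h₂ : IsZero (hm.grObj i L) := IsZero.of_epi (hm.grMap i p) (IsZero.of_mono (hm.grMap i j) h₁)
  exact Simple.not_isZero L (h₂.of_iso
    (hm.grIso (weightPart_of_simple wt hL (by simp [i]))).symm)

/-- All graded pieces of the image of `f` vanish, so the image has no weights at all. -/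
lemma eq_zero_of_grMap_eq_zero {X Y : M} (f : X ⟶ Y) (h : ∀ i, hm.grMap i f = 0) : f = 0 := by
  have h₁ : weightPart wt ∅ (Abelian.image f) := by
    rw [hm.weightPart_iff_isZero_grObj]
    intro i _
    have := hm.mono_grMap i (Abelian.image.ι f)
    have := hm.epi_grMap i (Abelian.factorThruImage f)
    have h0 := h i
    rw [← Abelian.image.fac f, grMap_comp] at h0
    have h1 : hm.grMap i (Abelian.factorThruImage f) = 0 := by
      rw [← cancel_mono (hm.grMap i (Abelian.image.ι f)), h0, zero_comp]
    rw [IsZero.iff_id_eq_zero, ← cancel_epi (hm.grMap i (Abelian.factorThruImage f)), h1,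
      zero_comp, zero_comp]
  have h₂ := isZero_of_weightPart_disjoint wt hm.finiteLength (Set.disjoint_empty _) h₁ h₁
  rw [← Abelian.image.fac f, h₂.eq_of_tgt (Abelian.factorThruImage f) 0, zero_comp]

/-- The extension class of consecutive graded pieces of the weight filtration. -/
noncomputable def grδ (i : ℤ) (X : M) :
    t.ιHeart.obj (hm.grObj i X) ⟶ (t.ιHeart.obj (hm.grObj (i + 1) X))⟦(1 : ℤ)⟧ :=
  connecting t (hm.filComplex_shortExact i X) ≫ (t.ιHeart.map (hm.grπ (i + 1) X))⟦1⟧'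

lemma grδ_naturality (i : ℤ) {X Y : M} (f : X ⟶ Y) :
    hm.grδ i X ≫ (t.ιHeart.map (hm.grMap (i + 1) f))⟦1⟧' =
      t.ιHeart.map (hm.grMap i f) ≫ hm.grδ i Y := by
  have h := connecting_naturality t (hm.filComplex_shortExact i X) (hm.filComplex_shortExact i Y)
    { τ₁ := hm.filMap (i + 1) f, τ₂ := hm.filMap i f, τ₃ := hm.grMap i f
      comm₁₂ := (hm.filIncl_filMap i f).symm, comm₂₃ := (hm.grπ_grMap i f).symm }
  dsimp only at h
  rw [grδ, grδ, Category.assoc, ← Functor.map_comp, ← Functor.map_comp, grπ_grMap,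
    Functor.map_comp, Functor.map_comp, reassoc_of% h]

/-- The composite contains the projection `F (i + 1) X ⟶ gr (i + 1) X` followed by the connecting
morphism of the same triangle. -/
lemma grδ_comp_grδ (i : ℤ) (X : M) : hm.grδ i X ≫ (hm.grδ (i + 1) X)⟦1⟧' = 0 := by
  have h : t.ιHeart.map (hm.grπ (i + 1) X) ≫
      connecting t (hm.filComplex_shortExact (i + 1) X) = 0 :=
    comp_distTriang_mor_zero₂₃ _ (connecting_distinguished t (hm.filComplex_shortExact (i + 1) X))
  rw [grδ, grδ, Category.assoc, ← Functor.map_comp, reassoc_of% h, zero_comp, Functor.map_zero,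
    comp_zero]

end IsMixed

end Filtration

/-! ### Linear complexes: additive and linear structure -/

section Linear

variable {D : Type*} [Category* D] [Preadditive D] [HasZeroObject D] [HasShift D ℤ]
  [∀ n : ℤ, (shiftFunctor D n).Additive] [Pretriangulated D] [IsTriangulated D]
  (t : TStructure D) {M : Type*} [Category* M] [Abelian M] [t.Heart M]
  (wt : Irr M → ℤ)

/-- The functor `X ↦ X[1]` on the heart. -/
noncomputable abbrev heartShift : M ⥤ D := t.ιHeart ⋙ shiftFunctor D (1 : ℤ)

/-- Linear complexes: sequences of objects of weights `-i` of the heart, with composable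
extension classes between consecutive terms. -/
structure LinearComplex where
  X : ℤ → M
  weight : ∀ i, weightPart wt {-i} (X i)
  d : ∀ i, t.ιHeart.obj (X i) ⟶ (heartShift t).obj (X (i + 1))
  d_comp_d : ∀ i, d i ≫ (d (i + 1))⟦(1 : ℤ)⟧' = 0
  bounded : ∃ a b : ℤ, ∀ i, (i < a ∨ b < i) → IsZero (X i)

namespace LinearComplex

variable {t wt}

/-- The morphisms of linear complexes, as a subgroup of the families of morphisms. -/
def homSubgroup (A B : LinearComplex t wt) : AddSubgroup (∀ i, A.X i ⟶ B.X i) where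
  carrier := {f | ∀ i, A.d i ≫ (heartShift t).map (f (i + 1)) = t.ιHeart.map (f i) ≫ B.d i}
  add_mem' {f g} hf hg i := by
    simp only [Pi.add_apply, Functor.map_add, Preadditive.comp_add, Preadditive.add_comp, hf i,
      hg i]
  zero_mem' i := by
    simp only [Pi.zero_apply, Functor.map_zero, comp_zero, zero_comp]
  neg_mem' {f} hf i := by
    simp only [Pi.neg_apply, Functor.map_neg, Preadditive.comp_neg, Preadditive.neg_comp, hf i]

instance : Category (LinearComplex t wt) where
  Hom A B := homSubgroup A B
  id A := ⟨fun i => 𝟙 (A.X i), fun i => by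
    rw [CategoryTheory.Functor.map_id, CategoryTheory.Functor.map_id, Category.comp_id,
      Category.id_comp]⟩
  comp {A B C} f g := ⟨fun i => f.1 i ≫ g.1 i, fun i => by
    have hf := f.2 i
    have hg := g.2 i
    rw [Functor.map_comp, Functor.map_comp, Category.assoc, ← hg, ← Category.assoc, hf,
      Category.assoc]⟩
  id_comp f := Subtype.ext (funext fun i => Category.id_comp _)
  comp_id f := Subtype.ext (funext fun i => Category.comp_id _)
  assoc f g h := Subtype.ext (funext fun i => Category.assoc _ _ _)

variable {A B C : LinearComplex t wt}

/-- The components of a morphism of linear complexes. -/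
def app (f : A ⟶ B) (i : ℤ) : A.X i ⟶ B.X i := f.1 i

lemma app_comm (f : A ⟶ B) (i : ℤ) :
    A.d i ≫ (heartShift t).map (app f (i + 1)) = t.ιHeart.map (app f i) ≫ B.d i := f.2 i

/-- Constructor for morphisms of linear complexes. -/
def mkHom (f : ∀ i, A.X i ⟶ B.X i)
    (h : ∀ i, A.d i ≫ (heartShift t).map (f (i + 1)) = t.ιHeart.map (f i) ≫ B.d i) : A ⟶ B :=
  ⟨f, h⟩

@[simp]
lemma mkHom_app (f : ∀ i, A.X i ⟶ B.X i)
    (h : ∀ i, A.d i ≫ (heartShift t).map (f (i + 1)) = t.ιHeart.map (f i) ≫ B.d i) (i : ℤ) :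
    app (mkHom f h) i = f i := rfl

@[ext]
lemma hom_ext {f g : A ⟶ B} (h : ∀ i, app f i = app g i) : f = g := Subtype.ext (funext h)

@[simp]
lemma id_app (i : ℤ) : app (𝟙 A) i = 𝟙 _ := rfl

@[simp]
lemma comp_app (f : A ⟶ B) (g : B ⟶ C) (i : ℤ) : app (f ≫ g) i = app f i ≫ app g i := rfl

instance : Preadditive (LinearComplex t wt) where
  homGroup A B := inferInstanceAs (AddCommGroup (homSubgroup A B))
  add_comp _ _ _ _ _ _ := Subtype.ext (funext fun _ => Preadditive.add_comp _ _ _ _ _ _)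
  comp_add _ _ _ _ _ _ := Subtype.ext (funext fun _ => Preadditive.comp_add _ _ _ _ _ _)

@[simp]
lemma zero_app (i : ℤ) : app (0 : A ⟶ B) i = 0 := rfl

lemma app_eq_zero_of_isZero (f : A ⟶ B) (h : f = 0) (i : ℤ) : app f i = 0 := by
  rw [h, zero_app]

lemma isZero_of_isZero_X (h : ∀ i, IsZero (A.X i)) : IsZero A := by
  rw [IsZero.iff_id_eq_zero]
  ext i
  exact (h i).eq_of_src _ _

lemma isZero_X_of_isZero (h : IsZero A) (i : ℤ) : IsZero (A.X i) := by
  rw [IsZero.iff_id_eq_zero] at h ⊢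
  exact app_eq_zero_of_isZero _ h i

/-- An isomorphism of linear complexes from isomorphisms of its components. -/
lemma isIso_of_isIso_app (f : A ⟶ B) (h : ∀ i, IsIso (app f i)) : IsIso f := by
  refine ⟨mkHom (fun i => inv (app f i)) fun i => ?_, ?_, ?_⟩
  · rw [← cancel_epi (t.ιHeart.map (app f i)), ← Category.assoc, ← app_comm, Category.assoc,
      ← Functor.map_comp, IsIso.hom_inv_id, CategoryTheory.Functor.map_id, Category.comp_id,
      ← Category.assoc, ← Functor.map_comp, IsIso.hom_inv_id, CategoryTheory.Functor.map_id,
      Category.id_comp]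
  · ext i; simp
  · ext i; simp

lemma mono_of_mono_app (f : A ⟶ B) (h : ∀ i, Mono (app f i)) : Mono f :=
  ⟨fun g k hgk => hom_ext fun i => by
    have := h i
    rw [← cancel_mono (app f i), ← comp_app, ← comp_app, hgk]⟩

lemma epi_of_epi_app (f : A ⟶ B) (h : ∀ i, Epi (app f i)) : Epi f :=
  ⟨fun g k hgk => hom_ext fun i => by
    have := h i
    rw [← cancel_epi (app f i), ← comp_app, ← comp_app, hgk]⟩

section Field

variable {F : Type*} [Ring F] [CategoryTheory.Linear F D] [CategoryTheory.Linear F M]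
  [(t.ιHeart (H := M)).Linear F] [∀ n : ℤ, (shiftFunctor D n).Linear F]

instance : SMul F (A ⟶ B) where
  smul r f := mkHom (fun i => r • app f i) fun i => by
    rw [Functor.map_smul, Functor.map_smul, Linear.comp_smul, Linear.smul_comp, app_comm]

@[simp]
lemma smul_app (r : F) (f : A ⟶ B) (i : ℤ) : app (r • f) i = r • app f i := rfl

instance : Module F (A ⟶ B) :=
  Function.Injective.module F (AddSubgroup.subtype (homSubgroup A B)) Subtype.val_injective
    fun _ _ => rfl

instance : CategoryTheory.Linear F (LinearComplex t wt) where
  smul_comp _ _ _ r f g := hom_ext fun i => by simp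
  comp_smul _ _ _ f r g := hom_ext fun i => by simp

end Field

section Biproducts

/-- The zero linear complex. -/
noncomputable def zero : LinearComplex t wt where
  X _ := 0
  weight _ := (weightPart wt _).prop_zero
  d _ := 0
  d_comp_d _ := zero_comp
  bounded := ⟨0, 0, fun _ _ => isZero_zero M⟩

instance : HasZeroObject (LinearComplex t wt) :=
  ⟨zero, isZero_of_isZero_X fun _ => isZero_zero M⟩

lemma heart_biprod_hom_ext {X Y : M} {Z : D} {f g : t.ιHeart.obj (X ⊞ Y) ⟶ Z}
    (h₁ : t.ιHeart.map biprod.inl ≫ f = t.ιHeart.map biprod.inl ≫ g)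
    (h₂ : t.ιHeart.map biprod.inr ≫ f = t.ιHeart.map biprod.inr ≫ g) : f = g := by
  rw [← Category.id_comp f, ← Category.id_comp g, ← CategoryTheory.Functor.map_id,
    ← biprod.total, Functor.map_add, Functor.map_comp, Functor.map_comp,
    Preadditive.add_comp, Preadditive.add_comp, Category.assoc, Category.assoc, Category.assoc,
    Category.assoc, h₁, h₂]

/-- The differential of a direct sum. -/
noncomputable def biprodD (A B : LinearComplex t wt) (i : ℤ) :
    t.ιHeart.obj (A.X i ⊞ B.X i) ⟶ (heartShift t).obj (A.X (i + 1) ⊞ B.X (i + 1)) :=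
  t.ιHeart.map biprod.fst ≫ A.d i ≫ (heartShift t).map biprod.inl +
    t.ιHeart.map biprod.snd ≫ B.d i ≫ (heartShift t).map biprod.inr

lemma inl_biprodD (A B : LinearComplex t wt) (i : ℤ) :
    t.ιHeart.map biprod.inl ≫ biprodD A B i = A.d i ≫ (heartShift t).map biprod.inl := by
  rw [biprodD, Preadditive.comp_add, ← Functor.map_comp_assoc, ← Functor.map_comp_assoc,
    biprod.inl_fst, biprod.inl_snd, CategoryTheory.Functor.map_id, Functor.map_zero, zero_comp,
    add_zero, Category.id_comp]

lemma inr_biprodD (A B : LinearComplex t wt) (i : ℤ) :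
    t.ιHeart.map biprod.inr ≫ biprodD A B i = B.d i ≫ (heartShift t).map biprod.inr := by
  rw [biprodD, Preadditive.comp_add, ← Functor.map_comp_assoc, ← Functor.map_comp_assoc,
    biprod.inr_fst, biprod.inr_snd, CategoryTheory.Functor.map_id, Functor.map_zero, zero_comp,
    zero_add, Category.id_comp]

lemma biprodD_fst (A B : LinearComplex t wt) (i : ℤ) :
    biprodD A B i ≫ (heartShift t).map biprod.fst = t.ιHeart.map biprod.fst ≫ A.d i := by
  refine heart_biprod_hom_ext ?_ ?_
  · rw [← Category.assoc, inl_biprodD, Category.assoc, ← Functor.map_comp,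
      ← Functor.map_comp_assoc, biprod.inl_fst, biprod.inl_fst]
    simp
  · rw [← Category.assoc, inr_biprodD, Category.assoc, ← Functor.map_comp,
      ← Functor.map_comp_assoc, biprod.inr_fst, biprod.inr_fst]
    simp

lemma biprodD_snd (A B : LinearComplex t wt) (i : ℤ) :
    biprodD A B i ≫ (heartShift t).map biprod.snd = t.ιHeart.map biprod.snd ≫ B.d i := by
  refine heart_biprod_hom_ext ?_ ?_
  · rw [← Category.assoc, inl_biprodD, Category.assoc, ← Functor.map_comp,
      ← Functor.map_comp_assoc, biprod.inl_snd, biprod.inl_snd]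
    simp
  · rw [← Category.assoc, inr_biprodD, Category.assoc, ← Functor.map_comp,
      ← Functor.map_comp_assoc, biprod.inr_snd, biprod.inr_snd]
    simp

/-- The direct sum of linear complexes. -/
noncomputable def biprod (A B : LinearComplex t wt) : LinearComplex t wt where
  X i := A.X i ⊞ B.X i
  weight i := (weightPart wt _).prop_biprod (A.weight i) (B.weight i)
  d i := biprodD A B i
  d_comp_d i := by
    refine heart_biprod_hom_ext ?_ ?_
    · have h := A.d_comp_d i
      rw [comp_zero, ← Category.assoc, inl_biprodD, Category.assoc, Functor.comp_map,
        ← Functor.map_comp, inl_biprodD, Functor.map_comp, reassoc_of% h, zero_comp]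
    · have h := B.d_comp_d i
      rw [comp_zero, ← Category.assoc, inr_biprodD, Category.assoc, Functor.comp_map,
        ← Functor.map_comp, inr_biprodD, Functor.map_comp, reassoc_of% h, zero_comp]
  bounded := by
    obtain ⟨a, b, h⟩ := A.bounded
    obtain ⟨a', b', h'⟩ := B.bounded
    refine ⟨min a a', max b b', fun i hi => ?_⟩
    rw [biprod_isZero_iff]
    exact ⟨h i (by lia), h' i (by lia)⟩

/-- The direct sum of linear complexes, as a bicone. -/
noncomputable def biprodBicone (A B : LinearComplex t wt) : BinaryBicone A B where
  pt := biprod A B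
  fst := mkHom (fun _ => Limits.biprod.fst) (biprodD_fst A B)
  snd := mkHom (fun _ => Limits.biprod.snd) (biprodD_snd A B)
  inl := mkHom (fun _ => Limits.biprod.inl) fun i => (inl_biprodD A B i).symm
  inr := mkHom (fun _ => Limits.biprod.inr) fun i => (inr_biprodD A B i).symm
  inl_fst := hom_ext fun _ => biprod.inl_fst
  inl_snd := hom_ext fun _ => biprod.inl_snd
  inr_fst := hom_ext fun _ => biprod.inr_fst
  inr_snd := hom_ext fun _ => biprod.inr_snd

instance : HasBinaryBiproducts (LinearComplex t wt) where
  has_binary_biproduct A B := HasBinaryBiproduct.mk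
    { bicone := biprodBicone A B
      isBilimit := isBinaryBilimitOfTotal _ (hom_ext fun _ => biprod.total) }

instance : HasFiniteProducts (LinearComplex t wt) :=
  have : HasTerminal (LinearComplex t wt) := HasZeroObject.hasTerminal
  hasFiniteProducts_of_has_binary_and_terminal

end Biproducts

/-! ### Linear complexes form an abelian category -/

section Abelian

/-- Degreewise kernels are kernels. -/
lemma nonempty_isLimit_kernelFork (hm : IsMixed t wt) (f : A ⟶ B) (g : B ⟶ C) (w : f ≫ g = 0)
    (hmono : ∀ i, Mono (app f i))
    (hex : ∀ i, (ShortComplex.mk (app f i) (app g i)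
      (app_eq_zero_of_isZero _ w i)).Exact) :
    Nonempty (IsLimit (KernelFork.ofι f w)) := by
  have hr (i : ℤ) : ∃ r, app f i ≫ r = 𝟙 _ :=
    hm.exists_retraction (shortExact_cokernel (app f i)) (B.weight i)
  have := mono_of_mono_app f hmono
  refine ⟨KernelFork.IsLimit.ofι' f w fun {T} k hk => ?_⟩
  let l (i : ℤ) : T.X i ⟶ A.X i := (hex i).lift (app k i) (app_eq_zero_of_isZero _ hk i)
  have hl (i : ℤ) : l i ≫ app f i = app k i := (hex i).lift_f _ _
  refine ⟨mkHom l fun i => ?_, hom_ext hl⟩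
  obtain ⟨r, hr⟩ := hr (i + 1)
  -- A monomorphism of the heart need not stay one in `D`, where all monomorphisms split;
  -- semisimplicity of the single-weight category supplies the splitting.
  have h : Mono ((heartShift t).map (app f (i + 1))) := by
    have : IsSplitMono (app f (i + 1)) := ⟨⟨r, hr⟩⟩
    infer_instance
  rw [← cancel_mono ((heartShift t).map (app f (i + 1))), Category.assoc, Category.assoc,
    ← Functor.map_comp, hl, app_comm f, app_comm k, ← Functor.map_comp_assoc, hl]

/-- Degreewise cokernels are cokernels. -/
lemma nonempty_isColimit_cokernelCofork (hm : IsMixed t wt) (f : A ⟶ B) (g : B ⟶ C) (w : f ≫ g = 0)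
    (hepi : ∀ i, Epi (app g i))
    (hex : ∀ i, (ShortComplex.mk (app f i) (app g i)
      (app_eq_zero_of_isZero _ w i)).Exact) :
    Nonempty (IsColimit (CokernelCofork.ofπ g w)) := by
  have := epi_of_epi_app g hepi
  refine ⟨CokernelCofork.IsColimit.ofπ' g w fun {T} k hk => ?_⟩
  let l (i : ℤ) : C.X i ⟶ T.X i := (hex i).desc (app k i) (app_eq_zero_of_isZero _ hk i)
  have hl (i : ℤ) : app g i ≫ l i = app k i := (hex i).g_desc _ _
  refine ⟨mkHom l fun i => ?_, hom_ext hl⟩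
  obtain ⟨σ⟩ := hm.nonempty_splitting (shortExact_kernel (app g i)) (B.weight i)
  have h : Epi (t.ιHeart.map (app g i)) := by
    have : IsSplitEpi (app g i) := ⟨⟨σ.s, σ.s_g⟩⟩
    infer_instance
  rw [← cancel_epi (t.ιHeart.map (app g i)), ← Functor.map_comp_assoc, hl, ← app_comm k,
    ← Category.assoc, ← app_comm g, Category.assoc, ← Functor.map_comp, hl]

/-- Degreewise split short exact sequences compatible with the differential of `A`. -/
structure DegreewiseSplit (A : LinearComplex t wt) where
  K : ℤ → M
  Q : ℤ → M
  i : ∀ n, K n ⟶ A.X n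
  p : ∀ n, A.X n ⟶ Q n
  w : ∀ n, i n ≫ p n = 0
  σ : ∀ n, (ShortComplex.mk (i n) (p n) (w n)).Splitting
  compat : ∀ n, t.ιHeart.map (i n) ≫ A.d n ≫ (heartShift t).map (p (n + 1)) = 0

namespace DegreewiseSplit

variable (S : DegreewiseSplit A)

lemma i_r (n : ℤ) : S.i n ≫ (S.σ n).r = 𝟙 _ := (S.σ n).f_r

lemma s_p (n : ℤ) : (S.σ n).s ≫ S.p n = 𝟙 _ := (S.σ n).s_g

lemma total (n : ℤ) : (S.σ n).r ≫ S.i n + S.p n ≫ (S.σ n).s = 𝟙 (A.X n) := (S.σ n).id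

lemma mono_i (n : ℤ) : Mono (S.i n) := mono_of_mono_fac (S.i_r n)

lemma epi_p (n : ℤ) : Epi (S.p n) := epi_of_epi_fac (S.s_p n)

lemma mono_p {n : ℤ} (h : S.i n = 0) : Mono (S.p n) := by
  obtain ⟨r, s, hrs⟩ : ∃ (r : A.X n ⟶ S.K n) (s : S.Q n ⟶ A.X n),
      r ≫ S.i n + S.p n ≫ s = 𝟙 _ := ⟨_, _, S.total n⟩
  rw [h, comp_zero, zero_add] at hrs
  exact mono_of_mono_fac hrs

lemma epi_i {n : ℤ} (h : S.p n = 0) : Epi (S.i n) := by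
  obtain ⟨r, s, hrs⟩ : ∃ (r : A.X n ⟶ S.K n) (s : S.Q n ⟶ A.X n),
      r ≫ S.i n + S.p n ≫ s = 𝟙 _ := ⟨_, _, S.total n⟩
  rw [h, zero_comp, add_zero] at hrs
  exact epi_of_epi_fac hrs

lemma exact (n : ℤ) : (ShortComplex.mk (S.i n) (S.p n) (S.w n)).Exact := (S.σ n).exact

noncomputable def subD (n : ℤ) : t.ιHeart.obj (S.K n) ⟶ (heartShift t).obj (S.K (n + 1)) :=
  t.ιHeart.map (S.i n) ≫ A.d n ≫ (heartShift t).map (S.σ (n + 1)).r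

lemma subD_comm (n : ℤ) :
    S.subD n ≫ (heartShift t).map (S.i (n + 1)) = t.ιHeart.map (S.i n) ≫ A.d n := by
  have h := S.compat n
  rw [← Category.assoc] at h
  rw [subD, Category.assoc, Category.assoc, ← Functor.map_comp,
    eq_sub_of_add_eq (S.total (n + 1)), Functor.map_sub, Functor.map_comp, Preadditive.comp_sub,
    Preadditive.comp_sub, ← Category.assoc, ← Category.assoc, ← Category.assoc, h, zero_comp,
    sub_zero, CategoryTheory.Functor.map_id, Category.comp_id]

noncomputable def quotientD (n : ℤ) : t.ιHeart.obj (S.Q n) ⟶ (heartShift t).obj (S.Q (n + 1)) :=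
  t.ιHeart.map (S.σ n).s ≫ A.d n ≫ (heartShift t).map (S.p (n + 1))

lemma quotientD_comm (n : ℤ) :
    t.ιHeart.map (S.p n) ≫ S.quotientD n = A.d n ≫ (heartShift t).map (S.p (n + 1)) := by
  have h := congrArg (fun x => t.ιHeart.map x ≫ A.d n ≫ (heartShift t).map (S.p (n + 1)))
    (S.total n)
  simp only [Functor.map_add, Functor.map_comp, Preadditive.add_comp, Category.assoc, S.compat n,
    comp_zero, zero_add, CategoryTheory.Functor.map_id, Category.id_comp] at h
  rw [quotientD, h]

/-- The subobject defined by a degreewise split sequence. -/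
noncomputable def sub : LinearComplex t wt where
  X := S.K
  weight n := have := S.mono_i n; (weightPart wt _).prop_of_mono (S.i n) (A.weight n)
  d := S.subD
  d_comp_d n := by
    have h : Mono ((shiftFunctor D (1 : ℤ)).map ((heartShift t).map (S.i (n + 1 + 1)))) := by
      have : IsSplitMono (S.i (n + 1 + 1)) := ⟨⟨_, S.i_r _⟩⟩
      infer_instance
    have h' := A.d_comp_d n
    rw [← cancel_mono ((shiftFunctor D (1 : ℤ)).map ((heartShift t).map (S.i (n + 1 + 1)))),
      zero_comp, Category.assoc, ← Functor.map_comp, subD_comm, Functor.map_comp,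
      ← Functor.comp_map, ← Category.assoc, subD_comm, Category.assoc, h', comp_zero]
  bounded := by
    obtain ⟨a, b, h⟩ := A.bounded
    exact ⟨a, b, fun n hn => have := S.mono_i n; IsZero.of_mono (S.i n) (h n hn)⟩

/-- The quotient defined by a degreewise split sequence. -/
noncomputable def quotient : LinearComplex t wt where
  X := S.Q
  weight n := have := S.epi_p n; (weightPart wt _).prop_of_epi (S.p n) (A.weight n)
  d := S.quotientD
  d_comp_d n := by
    have h : Epi (t.ιHeart.map (S.p n)) := by
      have : IsSplitEpi (S.p n) := ⟨⟨_, S.s_p _⟩⟩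
      infer_instance
    have h' := A.d_comp_d n
    rw [← cancel_epi (t.ιHeart.map (S.p n)), comp_zero, ← Category.assoc, quotientD_comm,
      Category.assoc, Functor.comp_map, ← Functor.map_comp, quotientD_comm, Functor.map_comp,
      reassoc_of% h', zero_comp]
  bounded := by
    obtain ⟨a, b, h⟩ := A.bounded
    exact ⟨a, b, fun n hn => have := S.epi_p n; IsZero.of_epi (S.p n) (h n hn)⟩

noncomputable def subι : S.sub ⟶ A := mkHom S.i S.subD_comm

noncomputable def quotientπ : A ⟶ S.quotient := mkHom S.p fun n => (S.quotientD_comm n).symm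

lemma subι_quotientπ : S.subι ≫ S.quotientπ = 0 := hom_ext S.w

lemma quotientD_desc_comm (f : A ⟶ B) (g : ∀ n, S.Q n ⟶ B.X n)
    (h : ∀ n, S.p n ≫ g n = app f n) (n : ℤ) :
    S.quotientD n ≫ (heartShift t).map (g (n + 1)) = t.ιHeart.map (g n) ≫ B.d n := by
  have hp : Epi (t.ιHeart.map (S.p n)) := by
    have : IsSplitEpi (S.p n) := ⟨⟨_, S.s_p _⟩⟩
    infer_instance
  rw [← cancel_epi (t.ιHeart.map (S.p n)), ← Functor.map_comp_assoc, h, ← app_comm f,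
    ← Category.assoc, quotientD_comm, Category.assoc, ← Functor.map_comp, h]

/-- Morphisms out of the quotient, degreewise. -/
noncomputable def quotientDesc (f : A ⟶ B) (g : ∀ n, S.Q n ⟶ B.X n)
    (h : ∀ n, S.p n ≫ g n = app f n) : S.quotient ⟶ B :=
  mkHom g (S.quotientD_desc_comm f g h)

end DegreewiseSplit

/-- Take image factorisations degreewise. The differential preserves the kernels: this can be tested
after the split monomorphism `m`, where it follows from `f` being a chain map. -/
lemma exists_degreewise_kernel (hm : IsMixed t wt) (f : A ⟶ B) :
    ∃ (S : DegreewiseSplit A) (m : ∀ n, S.Q n ⟶ B.X n), (∀ n, Mono (m n)) ∧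
      ∀ n, S.p n ≫ m n = app f n := by
  have himage (n : ℤ) : ∃ (I : M) (e : A.X n ⟶ I) (m : I ⟶ B.X n), Epi e ∧ Mono m ∧
      e ≫ m = app f n :=
    ⟨_, Abelian.factorThruImage (app f n), Abelian.image.ι (app f n), inferInstance,
      inferInstance, Abelian.image.fac _⟩
  choose I e m he hm' fac using himage
  have split₁ (n : ℤ) : Nonempty _ := hm.nonempty_splitting (shortExact_kernel (e n)) (A.weight n)
  have split₂ (n : ℤ) : Nonempty _ :=
    hm.nonempty_splitting (shortExact_cokernel (m n)) (B.weight n)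
  have hm₁ (n : ℤ) : Mono ((heartShift t).map (m n)) := by
    have : IsSplitMono (m n) := ⟨⟨(split₂ n).some.r, (split₂ n).some.f_r⟩⟩
    infer_instance
  exact ⟨{ K := fun n => kernel (e n), Q := I
           i := fun n => kernel.ι (e n), p := e, w := fun n => kernel.condition _
           σ := fun n => (split₁ n).some
           compat := fun n => by
            rw [← cancel_mono ((heartShift t).map (m (n + 1))), zero_comp, Category.assoc,
              Category.assoc, ← Functor.map_comp, fac, app_comm, ← fac, ← Functor.map_comp_assoc,
              kernel.condition_assoc, zero_comp, Functor.map_zero, zero_comp] }, m, hm', fac⟩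

lemma exists_degreewise_cokernel (hm : IsMixed t wt) (f : A ⟶ B) (S : DegreewiseSplit A)
    (m : ∀ n, S.Q n ⟶ B.X n) (hmono : ∀ n, Mono (m n)) (fac : ∀ n, S.p n ≫ m n = app f n) :
    ∃ S' : DegreewiseSplit B, ∃ e : ∀ n, S.Q n ≅ S'.K n, ∀ n, m n = (e n).hom ≫ S'.i n := by
  have split₂ (n : ℤ) : Nonempty _ :=
    hm.nonempty_splitting (shortExact_cokernel (m n)) (B.weight n)
  have he₁ (n : ℤ) : Epi (t.ιHeart.map (S.p n)) := by
    have : IsSplitEpi (S.p n) := ⟨⟨_, S.s_p n⟩⟩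
    infer_instance
  exact ⟨{ K := S.Q, Q := fun n => cokernel (m n)
           i := m, p := fun n => cokernel.π (m n), w := fun n => cokernel.condition _
           σ := fun n => (split₂ n).some
           compat := fun n => by
            rw [← cancel_epi (t.ιHeart.map (S.p n)), comp_zero, ← Functor.map_comp_assoc, fac,
              ← Category.assoc, ← app_comm, Category.assoc, ← Functor.map_comp, ← fac,
              Category.assoc, cokernel.condition, comp_zero, Functor.map_zero, comp_zero] },
    fun n => Iso.refl _, fun n => (Category.id_comp _).symm⟩

/-- The image is the quotient of `A` by the degreewise kernel. It maps to `B` degreewise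
monomorphically, and this map is the kernel of the degreewise cokernel of `f`. -/
lemma nonempty_abelianStruct (hm : IsMixed t wt) (f : A ⟶ B) :
    Nonempty (Abelian.AbelianStruct f) := by
  obtain ⟨S, m, hmono, fac⟩ := exists_degreewise_kernel hm f
  obtain ⟨S', e, he⟩ := exists_degreewise_cokernel hm f S m hmono fac
  let g : S.quotient ⟶ B := S.quotientDesc f m fac
  have hg : S.quotientπ ≫ g = f := hom_ext fac
  have w₁ : S.subι ≫ f = 0 := by rw [← hg, ← Category.assoc, S.subι_quotientπ, zero_comp]
  have hπ : Epi S.quotientπ := epi_of_epi_app _ S.epi_p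
  have w₂ : g ≫ S'.quotientπ = 0 := hom_ext fun n => by
    change m n ≫ S'.p n = 0
    rw [he, Category.assoc, S'.w, comp_zero]
  have w₃ : f ≫ S'.quotientπ = 0 := by rw [← hg, Category.assoc, w₂, comp_zero]
  have hk (n : ℤ) : IsLimit (KernelFork.ofι (S.i n) (S.w n)) :=
    have := S.mono_i n; (S.exact n).fIsKernel
  have hc (n : ℤ) : IsColimit (CokernelCofork.ofπ (S'.p n) (S'.w n)) :=
    have := S'.epi_p n; (S'.exact n).gIsCokernel
  obtain ⟨l₁⟩ := nonempty_isLimit_kernelFork hm S.subι f w₁ S.mono_i (fun n =>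
    ShortComplex.exact_of_f_is_kernel _ (isKernelCompMono (hk n) (m n) (fac n).symm))
  have hme (n : ℤ) : app f n = (S.p n ≫ (e n).hom) ≫ S'.i n := by
    rw [← fac, he, Category.assoc]
  obtain ⟨l₂⟩ := nonempty_isColimit_cokernelCofork hm f S'.quotientπ w₃ S'.epi_p (fun n =>
    have := S.epi_p n
    ShortComplex.exact_of_g_is_cokernel _ (isCokernelEpiComp (hc n) (S.p n ≫ (e n).hom) (hme n)))
  obtain ⟨l₃⟩ := nonempty_isColimit_cokernelCofork hm S.subι S.quotientπ S.subι_quotientπ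
    S.epi_p S.exact
  obtain ⟨l₄⟩ := nonempty_isLimit_kernelFork hm g S'.quotientπ w₂ hmono (fun n =>
    ShortComplex.exact_of_g_is_cokernel _ (isCokernelEpiComp (hc n) (e n).hom (he n)))
  exact ⟨{
    kernelFork := _
    isLimitKernelFork := l₁
    cokernelCofork := _
    isColimitCokernelCofork := l₂
    image := S.quotient
    imageπ := S.quotientπ
    ι_imageπ := S.subι_quotientπ
    imageIsCokernel := l₃
    imageι := g
    imageι_π := w₂
    imageIsKernel := l₄
    fac := hg }⟩

/-- The category of linear complexes is abelian. -/
noncomputable abbrev abelian (hm : IsMixed t wt) : Abelian (LinearComplex t wt) :=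
  Abelian.mk' fun _ _ f => nonempty_abelianStruct hm f

/-- The inclusion of the degreewise kernel is itself a morphism of linear complexes killed by `f`,
so it is zero. -/
lemma mono_app (hm : IsMixed t wt) (f : A ⟶ B) [Mono f] (n : ℤ) : Mono (app f n) := by
  obtain ⟨S, m, hmono, fac⟩ := exists_degreewise_kernel hm f
  have h₀ : S.subι = 0 := by
    rw [← cancel_mono f, zero_comp]
    ext k
    change S.i k ≫ app f k = 0
    rw [← fac, ← Category.assoc, S.w, zero_comp]
  have h₁ : S.i n = 0 := app_eq_zero_of_isZero _ h₀ n
  have := S.mono_p h₁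
  have := hmono n
  rw [← fac]
  infer_instance

lemma epi_app (hm : IsMixed t wt) (f : A ⟶ B) [Epi f] (n : ℤ) : Epi (app f n) := by
  obtain ⟨S, m, hmono, fac⟩ := exists_degreewise_kernel hm f
  obtain ⟨S', e, he⟩ := exists_degreewise_cokernel hm f S m hmono fac
  have h₀ : S'.quotientπ = 0 := by
    rw [← cancel_epi f, comp_zero]
    ext k
    change app f k ≫ S'.p k = 0
    rw [← fac, he, Category.assoc, Category.assoc, S'.w, comp_zero, comp_zero]
  have h₁ : S'.p n = 0 := app_eq_zero_of_isZero _ h₀ n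
  have := S'.epi_i h₁
  have := S.epi_p n
  rw [← fac, he]
  infer_instance

variable (t wt) in
/-- The linear complexes all of whose weights lie in `S`. -/
def supported (S : Set ℤ) : ObjectProperty (LinearComplex t wt) := fun A =>
  ∀ i, -i ∉ S → IsZero (A.X i)

lemma isSerreClass_supported (hm : IsMixed t wt) (S : Set ℤ) :
    letI := abelian hm
    (supported t wt S).IsSerreClass :=
  letI := abelian hm
  { exists_zero := ⟨zero, isZero_of_isZero_X fun _ => isZero_zero M, fun _ _ => isZero_zero M⟩
    prop_of_mono := fun f _ h i hi => have := mono_app hm f i; IsZero.of_mono (app f i) (h i hi)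
    prop_of_epi := fun f _ h i hi => have := epi_app hm f i; IsZero.of_epi (app f i) (h i hi)
    prop_X₂_of_shortExact := fun {C} hC h₁ h₃ n hn => by
      have := hC.mono_f
      -- The degreewise kernel of `C.g` factors through `C.X₁`, which vanishes in degree `n`; so
      -- `C.g` is mono there, with zero target.
      obtain ⟨S, m, hmono, fac⟩ := exists_degreewise_kernel hm C.g
      have hw : S.subι ≫ C.g = 0 := by
        ext k
        change S.i k ≫ app C.g k = 0
        rw [← fac, ← Category.assoc, S.w, zero_comp]
      have hl := hC.exact.lift_f S.subι hw
      have h₄ : S.i n = 0 := by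
        have h₅ := congrArg (fun x => app x n) hl
        refine h₅.symm.trans ?_
        rw [comp_app, (h₁ n hn).eq_of_src (app C.f n) 0, comp_zero]
        rfl
      have := S.mono_p h₄
      have := hmono n
      have : Mono (app C.g n) := by rw [← fac]; infer_instance
      exact IsZero.of_mono (app C.g n) (h₃ n hn) }

/-- A linear complex concentrated in one degree, where it is simple, is simple. -/
lemma simple_of_concentrated (hm : IsMixed t wt) {i : ℤ} (h₁ : Simple (A.X i))
    (h₂ : ∀ j, j ≠ i → IsZero (A.X j)) : Simple A where
  mono_isIso_iff_nonzero {Y} f hf := by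
    have hmono := mono_app hm f
    refine ⟨?_, fun h0 => isIso_of_isIso_app f fun j => ?_⟩
    · rintro hi rfl
      have : 𝟙 A = 0 := by rw [← cancel_epi (0 : Y ⟶ A)]; simp
      exact Simple.not_isZero (A.X i)
        (isZero_X_of_isZero ((IsZero.iff_id_eq_zero A).2 this) i)
    · by_cases hj : j = i
      · subst hj
        refine isIso_of_mono_of_nonzero fun h => h0 ?_
        ext k
        by_cases hk : k = j
        · subst hk; exact h
        · exact (h₂ k hk).eq_of_tgt _ _
      · have h := h₂ j hj
        exact (IsZero.of_mono (app f j) h).isIso h _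

end Abelian

end LinearComplex

end Linear

/-! ### From the heart to linear complexes -/

section ToLinear

variable {D : Type*} [Category* D] [Preadditive D] [HasZeroObject D] [HasShift D ℤ]
  [∀ n : ℤ, (shiftFunctor D n).Additive] [Pretriangulated D] [IsTriangulated D]
  {t : TStructure D} {M : Type*} [Category* M] [Abelian M] [t.Heart M]
  {wt : Irr M → ℤ}

namespace IsMixed

variable (hm : IsMixed t wt)

/-- The linear complex of the graded pieces of the weight filtration. -/
noncomputable def grComplex (X : M) : LinearComplex t wt where
  X i := hm.grObj i X
  weight i := hm.weightPart_grObj i X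
  d i := hm.grδ i X
  d_comp_d i := hm.grδ_comp_grδ i X
  bounded := by
    obtain ⟨a, b, h⟩ := exists_weightPart_Icc (wt := wt) hm.finiteLength X
    refine ⟨-b, -a, fun i hi => hm.isZero_grObj h ?_⟩
    rw [Set.mem_Icc]
    lia

/-- The functor sending an object of the heart to the graded pieces of its weight filtration. -/
noncomputable def toLinear : M ⥤ LinearComplex t wt where
  obj X := hm.grComplex X
  map f := LinearComplex.mkHom (fun i => hm.grMap i f) fun i => hm.grδ_naturality i f
  map_id X := LinearComplex.hom_ext fun i => hm.grMap_id i X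
  map_comp f g := LinearComplex.hom_ext fun i => hm.grMap_comp i f g

instance : hm.toLinear.Additive where
  map_add := LinearComplex.hom_ext fun i => hm.grMap_add i _ _

instance {F : Type*} [Ring F] [CategoryTheory.Linear F D] [CategoryTheory.Linear F M]
    [(t.ιHeart (H := M)).Linear F] [∀ n : ℤ, (shiftFunctor D n).Linear F] :
    hm.toLinear.Linear F where
  map_smul f r := LinearComplex.hom_ext fun i => hm.grMap_smul i r f

instance : hm.toLinear.Faithful where
  map_injective {X Y} f g h := by
    rw [← sub_eq_zero]
    refine hm.eq_zero_of_grMap_eq_zero _ fun i => ?_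
    exact LinearComplex.app_eq_zero_of_isZero (hm.toLinear.map (f - g))
      (by rw [Functor.map_sub, h, sub_self]) i

/-- Short exact sequences suffice, and these are preserved because each `gr i` is exact and
degreewise kernels are kernels. -/
lemma preservesFiniteLimits_and_colimits_toLinear :
    PreservesFiniteLimits hm.toLinear ∧ PreservesFiniteColimits hm.toLinear := by
  let := LinearComplex.abelian hm
  refine ((Functor.exact_tfae hm.toLinear).out 0 3).1 fun S hS => ?_
  have hgr (i : ℤ) := hm.grMap_shortExact i hS
  have hmono (i : ℤ) : Mono (hm.grMap i S.f) := (hgr i).mono_f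
  have hepi (i : ℤ) : Epi (hm.grMap i S.g) := (hgr i).epi_g
  have hf : Mono (hm.toLinear.map S.f) := LinearComplex.mono_of_mono_app _ hmono
  have hg : Epi (hm.toLinear.map S.g) := LinearComplex.epi_of_epi_app _ hepi
  obtain ⟨l⟩ := LinearComplex.nonempty_isLimit_kernelFork hm (hm.toLinear.map S.f)
    (hm.toLinear.map S.g) (S.map hm.toLinear).zero hmono fun i => (hgr i).exact
  exact { exact := ShortComplex.exact_of_f_is_kernel _ l
          mono_f := hf
          epi_g := hg }

lemma simple_toLinear_obj {L : M} (hL : Simple L) : Simple (hm.toLinear.obj L) := by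
  have hw := weightPart_of_simple (S := {-(-wt (irrClass L hL))}) wt hL (by simp)
  have : Simple ((hm.toLinear.obj L).X (-wt (irrClass L hL))) :=
    Simple.of_iso (hm.grIso hw)
  refine LinearComplex.simple_of_concentrated hm this fun j hj => hm.isZero_grObj hw ?_
  rw [Set.mem_singleton_iff]
  lia

lemma weightPart_iff_supported (S : Set ℤ) (X : M) :
    weightPart wt S X ↔ LinearComplex.supported t wt S (hm.toLinear.obj X) :=
  hm.weightPart_iff_isZero_grObj S X

lemma weightPart_X_of_mem {A : LinearComplex t wt} {S : Set ℤ} {i : ℤ} (hi : -i ∈ S) :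
    weightPart wt S (A.X i) :=
  weightPart_mono wt (by simpa using hi) _ (A.weight i)

lemma isIso_filι_of_weightPart_Icc {i : ℤ} {X : M}
    (h : weightPart wt (Set.Icc (-(i + 1)) (-i)) X) : IsIso (hm.filι i X) :=
  hm.isIso_filι i (weightPart_mono wt Set.Icc_subset_Iic_self _ h)

lemma isIso_grπ_of_weightPart_Icc {i : ℤ} {X : M}
    (h : weightPart wt (Set.Icc (-(i + 1)) (-i)) X) : IsIso (hm.grπ (i + 1) X) :=
  hm.isIso_grπ (i + 1) (hm.isZero_filObj (i + 1 + 1)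
    (weightPart_mono wt (fun k hk => by simp only [Set.mem_Icc, Set.mem_Ioi] at *; lia) _ h))

/-- The functor `toLinear` is full on objects with two consecutive weights. -/
lemma exists_toLinear_map_eq {i : ℤ} {X Y : M} (hX : weightPart wt (Set.Icc (-(i + 1)) (-i)) X)
    (hY : weightPart wt (Set.Icc (-(i + 1)) (-i)) Y)
    (g : hm.toLinear.obj X ⟶ hm.toLinear.obj Y) : ∃ f : X ⟶ Y, hm.toLinear.map f = g := by
  have := hm.isIso_filι_of_weightPart_Icc hX
  have := hm.isIso_grπ_of_weightPart_Icc hY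
  let a : hm.grObj i X ⟶ hm.grObj i Y := LinearComplex.app g i
  let b : hm.grObj (i + 1) X ⟶ hm.grObj (i + 1) Y := LinearComplex.app g (i + 1)
  -- Since `F (i + 2) Y = 0`, the step `F (i + 1) Y` is its own graded piece. Thus `g` amounts to a
  -- pair of maps between the ends of two extensions, compatible with their classes.
  let b' : hm.filObj (i + 1) X ⟶ hm.filObj (i + 1) Y :=
    hm.grπ (i + 1) X ≫ b ≫ inv (hm.grπ (i + 1) Y)
  have hb' : b' ≫ hm.grπ (i + 1) Y = hm.grπ (i + 1) X ≫ b := by simp [b']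
  have hg : hm.grδ i X ≫ (t.ιHeart.map b)⟦(1 : ℤ)⟧' = t.ιHeart.map a ≫ hm.grδ i Y :=
    LinearComplex.app_comm g i
  have hδ : connecting t (hm.filComplex_shortExact i X) ≫ (t.ιHeart.map b')⟦(1 : ℤ)⟧' =
      t.ιHeart.map a ≫ connecting t (hm.filComplex_shortExact i Y) := by
    rw [← cancel_mono ((t.ιHeart.map (hm.grπ (i + 1) Y))⟦(1 : ℤ)⟧'), Category.assoc,
      ← Functor.map_comp, ← Functor.map_comp, hb', Functor.map_comp, Functor.map_comp,
      Category.assoc]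
    simpa only [grδ, Category.assoc] using hg
  obtain ⟨u, hu₁, hu₂⟩ := distinguished_complete₂
    (connecting_distinguished t (hm.filComplex_shortExact i X))
    (connecting_distinguished t (hm.filComplex_shortExact i Y)) _ _ hδ
  obtain ⟨u, rfl⟩ := t.ιHeart.map_surjective u
  replace hu₁ : hm.filIncl i X ≫ u = b' ≫ hm.filIncl i Y :=
    t.ιHeart.map_injective (by simpa only [Functor.map_comp] using hu₁)
  replace hu₂ : hm.grπ i X ≫ a = u ≫ hm.grπ i Y :=
    t.ιHeart.map_injective (by simpa only [Functor.map_comp] using hu₂)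
  refine ⟨inv (hm.filι i X) ≫ u ≫ hm.filι i Y, LinearComplex.hom_ext fun j => ?_⟩
  have h₁ : hm.filMap i (inv (hm.filι i X) ≫ u ≫ hm.filι i Y) = u := by
    simp [← cancel_mono (hm.filι i Y)]
  have h₂ : hm.filMap (i + 1) (inv (hm.filι i X) ≫ u ≫ hm.filι i Y) = b' := by
    rw [← cancel_mono (hm.filIncl i Y), ← filIncl_filMap, h₁, hu₁]
  by_cases hj : j = i
  · subst hj
    change hm.grMap j _ = a
    rw [← cancel_epi (hm.grπ j X), grπ_grMap, h₁]
    exact hu₂.symm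
  · by_cases hj' : j = i + 1
    · subst hj'
      change hm.grMap (i + 1) _ = b
      rw [← cancel_epi (hm.grπ (i + 1) X), grπ_grMap, h₂]
      exact hb'
    · exact (hm.isZero_grObj hX (by rw [Set.mem_Icc]; lia)).eq_of_src _ _

/-- Every linear complex with two consecutive weights is isomorphic to an object of the image of
`toLinear`. -/
lemma exists_toLinear_obj_iso {i : ℤ} {A : LinearComplex t wt}
    (hA : LinearComplex.supported t wt (Set.Icc (-(i + 1)) (-i)) A) :
    ∃ X : M, weightPart wt (Set.Icc (-(i + 1)) (-i)) X ∧ Nonempty (hm.toLinear.obj X ≅ A) := by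
  obtain ⟨X, f, g, hT⟩ := exists_extension t (A.d i)
  have hfg : f ≫ g = 0 := t.ιHeart.map_injective (by
    rw [Functor.map_comp, Functor.map_zero]
    exact comp_distTriang_mor_zero₁₂ _ hT)
  have hS : (ShortComplex.mk f g hfg).ShortExact := shortExact_of_distinguished t (A.d i) hT
  have hX : weightPart wt (Set.Icc (-(i + 1)) (-i)) X :=
    (weightPart wt _).prop_X₂_of_shortExact hS
      (weightPart_X_of_mem (Set.mem_Icc.2 (by lia))) (weightPart_X_of_mem (Set.mem_Icc.2 (by lia)))
  refine ⟨X, hX, ?_⟩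
  have := hm.isIso_filι_of_weightPart_Icc hX
  have := hm.isIso_grπ_of_weightPart_Icc hX
  have : Mono f := hS.mono_f
  have : Epi g := hS.epi_g
  let u : A.X (i + 1) ⟶ hm.filObj (i + 1) X :=
    hm.filLift (weightPart_X_of_mem (Set.mem_Iic.2 le_rfl)) f
  have hu : u ≫ hm.filι (i + 1) X = f := hm.filLift_filι _ _
  -- The sub `A.X (i + 1)` is exactly `F (i + 1) X`, since `F (i + 1) X` has no nonzero map to `A.X
  -- i`, of weight `-i`.
  obtain ⟨k, hk⟩ : ∃ k, k ≫ f = hm.filι (i + 1) X := by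
    refine ⟨_, hS.exact.lift_f (hm.filι (i + 1) X) (hom_eq_zero_of_weightPart_disjoint wt
      hm.finiteLength (S := Set.Iic (-(i + 1))) (T := {-i}) ?_ (hm.weightPart_filObj _ _)
      (A.weight i) _)⟩
    rw [Set.disjoint_singleton_right, Set.mem_Iic]
    lia
  have : IsIso u := ⟨k, by simp [← cancel_mono f, hk, hu],
    by simp [← cancel_mono (hm.filι (i + 1) X), hk, hu]⟩
  have hv₀ : f ≫ inv (hm.filι i X) ≫ hm.grπ i X = 0 := by
    rw [← hu, ← filIncl_filι, Category.assoc, Category.assoc, IsIso.hom_inv_id_assoc,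
      filIncl_grπ, comp_zero]
  let v : A.X i ⟶ hm.grObj i X :=
    hS.exact.desc (inv (hm.filι i X) ≫ hm.grπ i X) hv₀
  have hv : g ≫ v = inv (hm.filι i X) ≫ hm.grπ i X :=
    hS.exact.g_desc _ _
  let φ : ShortComplex.mk f g hfg ⟶ hm.filComplex i X :=
    { τ₁ := u, τ₂ := inv (hm.filι i X), τ₃ := v
      comm₁₂ := by
        change u ≫ hm.filIncl i X = f ≫ inv (hm.filι i X)
        rw [← cancel_mono (hm.filι i X)]
        simp [hu]
      comm₂₃ := hv.symm }
  have hφ : A.d i ≫ (t.ιHeart.map u)⟦(1 : ℤ)⟧' =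
      t.ιHeart.map v ≫ connecting t (hm.filComplex_shortExact i X) :=
    distinguished_naturality t φ hT (connecting_distinguished t _)
  obtain ⟨v', hv'⟩ : ∃ v', hm.grπ i X ≫ v' = hm.filι i X ≫ g :=
    ⟨_, (hm.filComplex_shortExact i X).exact.g_desc (hm.filι i X ≫ g) (by
      change hm.filIncl i X ≫ hm.filι i X ≫ g = 0
      rw [filIncl_filι_assoc, ← hk, Category.assoc, hfg, comp_zero])⟩
  have : IsIso v := ⟨v',
    by rw [← cancel_epi g, reassoc_of% hv, hv', IsIso.inv_hom_id_assoc, Category.comp_id],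
    by rw [← cancel_epi (hm.grπ i X), reassoc_of% hv', hv, IsIso.hom_inv_id_assoc,
      Category.comp_id]⟩
  let w : A.X (i + 1) ⟶ hm.grObj (i + 1) X := u ≫ hm.grπ (i + 1) X
  -- Outside the degrees `i` and `i + 1` both sides are zero objects, so the default value `0` is an
  -- isomorphism there.
  let ψ : ∀ j, A.X j ⟶ hm.grObj j X :=
    Function.update (Function.update (fun j => 0) i v) (i + 1) w
  have hψ₁ : ψ i = v := by
    rw [show ψ i = _ from Function.update_of_ne (by lia) _ _, Function.update_self]
  have hψ₂ : ψ (i + 1) = w := Function.update_self _ _ _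
  have hz {j : ℤ} (hj : j ≠ i) (hj' : j ≠ i + 1) : IsZero (A.X j) :=
    hA j (by rw [Set.mem_Icc]; lia)
  have hz' {j : ℤ} (hj : j ≠ i) (hj' : j ≠ i + 1) : IsZero (hm.grObj j X) :=
    hm.isZero_grObj hX (by rw [Set.mem_Icc]; lia)
  let Ψ : A ⟶ hm.toLinear.obj X := LinearComplex.mkHom ψ fun j => by
    by_cases hj : j = i
    · subst hj
      rw [hψ₁, hψ₂]
      change A.d j ≫ (t.ιHeart.map (u ≫ hm.grπ (j + 1) X))⟦(1 : ℤ)⟧' =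
        t.ιHeart.map v ≫ connecting t (hm.filComplex_shortExact j X) ≫
          (t.ιHeart.map (hm.grπ (j + 1) X))⟦1⟧'
      rw [Functor.map_comp, Functor.map_comp, ← Category.assoc, hφ, Category.assoc]
    · by_cases hj' : j = i + 1
      · exact ((heartShift t).map_isZero (hz' (j := j + 1) (by lia) (by lia))).eq_of_tgt _ _
      · exact (t.ιHeart.map_isZero (hz hj hj')).eq_of_src _ _
  have hΨ : IsIso Ψ := LinearComplex.isIso_of_isIso_app _ fun j => by
    change IsIso (ψ j)
    by_cases hj : j = i
    · subst hj
      rw [hψ₁]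
      infer_instance
    · by_cases hj' : j = i + 1
      · subst hj'
        rw [hψ₂]
        infer_instance
      · exact (hz hj hj').isIso (hz' hj hj') _
  exact ⟨(asIso Ψ).symm⟩

end IsMixed

end ToLinear

/-! ### Pure objects concentrated in one degree -/

section Pure

variable {D : Type*} [Category* D] [Preadditive D] [HasZeroObject D] [HasShift D ℤ]
  [∀ n : ℤ, (shiftFunctor D n).Additive] [Pretriangulated D] [IsTriangulated D]
  {t : TStructure D} {M : Type*} [Category* M] [Abelian M] [t.Heart M]
  {wt : Irr M → ℤ}

lemma isLE_heart_shift (t : TStructure D) [t.Heart M] (A : M) (i : ℤ) :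
    t.IsLE ((t.ιHeart.obj A)⟦i⟧) (-i) :=
  t.isLE_shift _ 0 i (-i)

lemma isGE_heart_shift (t : TStructure D) [t.Heart M] (A : M) (i : ℤ) :
    t.IsGE ((t.ιHeart.obj A)⟦i⟧) (-i) :=
  t.isGE_shift _ 0 i (-i)

/-- The only cohomology of `A[i]` is `A`, in degree `-i`, which is also the weight of `A`. -/
lemma isPure_heart_shift {i : ℤ} {A : M} (h : weightPart wt {-i} A) :
    isPure t wt ((t.ιHeart.obj A)⟦i⟧) := by
  intro j
  have hle := isLE_heart_shift t A i
  have hge := isGE_heart_shift t A i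
  by_cases hj : j = -i
  · subst hj
    have : t.IsGE ((t.truncLE (-i)).obj ((t.ιHeart.obj A)⟦i⟧)) (-i) := inferInstance
    let e : (t.truncGELE (-i) (-i)).obj ((t.ιHeart.obj A)⟦i⟧) ≅ (t.ιHeart.obj A)⟦i⟧ :=
      (asIso ((t.truncGEπ (-i)).app ((t.truncLE (-i)).obj ((t.ιHeart.obj A)⟦i⟧)))).symm ≪≫
        asIso ((t.truncLEι (-i)).app ((t.ιHeart.obj A)⟦i⟧))
    exact ⟨A, h, ⟨((shiftFunctorCompIsoId D i (-i) (by lia)).symm.app (t.ιHeart.obj A)) ≪≫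
      (shiftFunctor D (-i)).mapIso e.symm⟩⟩
  · have hz : IsZero ((t.truncGELE j j).obj ((t.ιHeart.obj A)⟦i⟧)) := by
      have : t.IsLE ((t.truncLE j).obj ((t.ιHeart.obj A)⟦i⟧)) (-i) := inferInstance
      have h₁ : t.IsLE ((t.truncGELE j j).obj ((t.ιHeart.obj A)⟦i⟧)) (-i) :=
        inferInstanceAs (t.IsLE ((t.truncGE j).obj ((t.truncLE j).obj _)) (-i))
      rcases lt_or_gt_of_ne hj with hj | hj
      · have : t.IsGE ((t.truncLE j).obj ((t.ιHeart.obj A)⟦i⟧)) (-i) := inferInstance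
        have h₂ : t.IsGE ((t.truncGELE j j).obj ((t.ιHeart.obj A)⟦i⟧)) (-i) :=
          inferInstanceAs (t.IsGE ((t.truncGE j).obj ((t.truncLE j).obj _)) (-i))
        exact t.isZero _ j (-i) hj
      · exact t.isZero _ (-i) j hj
    exact ⟨0, (weightPart wt _).prop_zero, ⟨((t.ιHeart (H := M)).map_isZero (isZero_zero M)).iso
      ((shiftFunctor D j).map_isZero hz)⟩⟩

/-- The object `A[i]` of `Pure(D)` for an object `A` of weight `-i` of the heart. -/
noncomputable abbrev pureObj {i : ℤ} {A : M} (h : weightPart wt {-i} A) : PureCat t wt :=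
  ⟨(t.ιHeart.obj A)⟦i⟧, isPure_heart_shift h⟩

lemma isZero_pureCat {X : PureCat t wt} (h : IsZero X.obj) : IsZero X := by
  rw [IsZero.iff_id_eq_zero]
  exact ObjectProperty.hom_ext _ (h.eq_of_src _ _)

/-- The functor `A ↦ A[i]` from the heart. -/
noncomputable abbrev heartShiftBy (t : TStructure D) [t.Heart M] (i : ℤ) : M ⥤ D :=
  t.ιHeart ⋙ shiftFunctor D i

lemma isZero_of_isZero_heartShiftBy {i : ℤ} {A : M} (h : IsZero ((heartShiftBy t i).obj A)) :
    IsZero A := by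
  rw [IsZero.iff_id_eq_zero] at h ⊢
  exact (heartShiftBy t i).map_injective
    (by rw [CategoryTheory.Functor.map_id, h, Functor.map_zero])

lemma indecOfDegree_pureObj {i : ℤ} {L : M} (hL : Simple L) (hw : wt (irrClass L hL) = -i) :
    indecOfDegree t wt (-i) (pureObj (t := t) (weightPart_of_simple wt hL hw)) :=
  ⟨L, hL, hw, ⟨eqToIso (by rw [neg_neg])⟩⟩

lemma sumOfDegree_pureObj (hm : IsMixed t wt) {i : ℤ} {A : M} (h : weightPart wt {-i} A) :
    sumOfDegree t wt (-i) (pureObj (t := t) h) := by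
  obtain ⟨k, L, π, ι, hL, h₁, h₀, hs⟩ := hm.exists_decomposition h
  have hL' (j : Fin k) : weightPart wt {-i} (L j) :=
    weightPart_of_simple wt (hL j).choose (hL j).choose_spec
  let b : Bicone (fun j => pureObj (t := t) (hL' j)) :=
    { pt := pureObj h
      π := fun j => ObjectProperty.homMk ((heartShiftBy t i).map (π j))
      ι := fun j => ObjectProperty.homMk ((heartShiftBy t i).map (ι j))
      ι_π := fun j j' => by
        split_ifs with hj
        · subst hj
          refine ObjectProperty.hom_ext _ ?_
          change (heartShiftBy t i).map (ι j) ≫ (heartShiftBy t i).map (π j) = 𝟙 _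
          rw [← Functor.map_comp, h₁, CategoryTheory.Functor.map_id]
        · refine ObjectProperty.hom_ext _ ?_
          change (heartShiftBy t i).map (ι j) ≫ (heartShiftBy t i).map (π j') = 0
          rw [← Functor.map_comp, h₀ j j' hj, Functor.map_zero] }
  refine ⟨k, _, b, fun j => indecOfDegree_pureObj (hL j).choose (hL j).choose_spec,
    ⟨isBilimitOfTotal b ?_⟩, ⟨Iso.refl _⟩⟩
  apply (isPure t wt).ι.map_injective
  rw [Functor.map_sum]
  change ∑ j, (heartShiftBy t i).map (π j) ≫ (heartShiftBy t i).map (ι j) = 𝟙 _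
  simp only [← Functor.map_comp]
  rw [← Functor.map_sum, hs, CategoryTheory.Functor.map_id]

lemma IsMixed.weightPart_biproduct (hm : IsMixed t wt) {S : Set ℤ} {k : ℕ} (L : Fin k → M)
    [HasBiproduct L] (h : ∀ j, weightPart wt S (L j)) : weightPart wt S (⨁ L) := by
  refine (hm.weightPart_iff_isZero_grObj _ _).2 fun i hi => ?_
  rw [IsZero.iff_id_eq_zero, ← grMap_id, ← biproduct.total]
  refine (map_sum (AddMonoidHom.mk' (hm.grMap (X := ⨁ L) (Y := ⨁ L) i) (hm.grMap_add i)) _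
    _).trans (Finset.sum_eq_zero fun j _ => ?_)
  change hm.grMap i (biproduct.π L j ≫ biproduct.ι L j) = 0
  rw [grMap_comp, (hm.isZero_grObj (h j) hi).eq_of_tgt (hm.grMap i (biproduct.π L j)) 0, zero_comp]

/-- Both the inclusion of `Pure(D)` and `A ↦ A[i]` are additive, so the direct sum may be formed in
the heart before shifting. -/
lemma exists_pureObj_of_sumOfDegree (hm : IsMixed t wt) {i : ℤ} {X : PureCat t wt}
    (h : sumOfDegree t wt (-i) X) :
    ∃ A : M, weightPart wt {-i} A ∧ Nonempty (X.obj ≅ (t.ιHeart.obj A)⟦i⟧) := by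
  obtain ⟨k, S, b, hS, ⟨hb⟩, ⟨e⟩⟩ := h
  choose L hL hw eL using hS
  have : HasFiniteBiproducts M := Abelian.hasFiniteBiproducts
  let a (j : Fin k) : (isPure t wt).ι.obj (S j) ≅ (heartShiftBy t i).obj (L j) :=
    (eL j).some ≪≫ eqToIso (by rw [neg_neg]; rfl)
  let b₁ := (isPure t wt).ι.mapBicone b
  let b₂ := (heartShiftBy t i).mapBicone (biproduct.bicone L)
  have hb₁ : b₁.IsBilimit := isBilimitOfPreserves _ hb
  have hb₂ : b₂.IsBilimit := isBilimitOfPreserves _ (biproduct.isBilimit L)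
  have : HasBiproduct ((isPure t wt).ι.obj ∘ S) := HasBiproduct.mk ⟨b₁, hb₁⟩
  have : HasBiproduct ((heartShiftBy t i).obj ∘ L) := HasBiproduct.mk ⟨b₂, hb₂⟩
  exact ⟨⨁ L, hm.weightPart_biproduct L fun j => weightPart_of_simple wt (hL j) (hw j),
    ⟨(isPure t wt).ι.mapIso e ≪≫ biproduct.uniqueUpToIso _ hb₁ ≪≫
    biproduct.mapIso a ≪≫ (biproduct.uniqueUpToIso _ hb₂).symm⟩⟩

end Pure

/-! ### Linear complexes as complexes in `Pure(D)` -/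

section Complex

variable {D : Type*} [Category* D] [Preadditive D] [HasZeroObject D] [HasShift D ℤ]
  [∀ n : ℤ, (shiftFunctor D n).Additive] [Pretriangulated D] [IsTriangulated D]
  {t : TStructure D} {M : Type*} [Category* M] [Abelian M] [t.Heart M]
  {wt : Irr M → ℤ}

/-- The morphism `A[i] ⟶ B[i + 1]` defined by `A ⟶ B[1]`. -/
noncomputable def shiftD (t : TStructure D) [t.Heart M] (i : ℤ) {A B : M}
    (d : t.ιHeart.obj A ⟶ (heartShift t).obj B) :
    (heartShiftBy t i).obj A ⟶ (heartShiftBy t (i + 1)).obj B :=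
  d⟦i⟧' ≫ (shiftFunctorAdd' D 1 i (i + 1) (by lia)).inv.app (t.ιHeart.obj B)

lemma shiftD_bijective (t : TStructure D) [t.Heart M] (i : ℤ) (A B : M) :
    Function.Bijective (shiftD t i (A := A) (B := B)) := by
  refine ⟨fun d d' h => ?_, fun e => ?_⟩
  · exact (shiftFunctor D i).map_injective
      ((cancel_mono ((shiftFunctorAdd' D 1 i (i + 1) (by lia)).inv.app (t.ιHeart.obj B))).1 h)
  · obtain ⟨d, hd⟩ := (shiftFunctor D i).map_surjective
      (e ≫ (shiftFunctorAdd' D 1 i (i + 1) (by lia)).hom.app (t.ιHeart.obj B))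
    refine ⟨d, ?_⟩
    rw [shiftD, hd, Category.assoc, Iso.hom_inv_id_app]
    exact Category.comp_id _

lemma map_shiftD {i : ℤ} {A A' B : M} (f : A ⟶ A') (d : t.ιHeart.obj A' ⟶ (heartShift t).obj B) :
    (heartShiftBy t i).map f ≫ shiftD t i d = shiftD t i (t.ιHeart.map f ≫ d) := by
  rw [shiftD, shiftD, Functor.map_comp, Category.assoc]
  rfl

lemma shiftD_map {i : ℤ} {A B B' : M} (d : t.ιHeart.obj A ⟶ (heartShift t).obj B) (f : B ⟶ B') :
    shiftD t i d ≫ (heartShiftBy t (i + 1)).map f = shiftD t i (d ≫ (heartShift t).map f) := by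
  have h := (shiftFunctorAdd' D 1 i (i + 1) (by lia)).inv.naturality (t.ιHeart.map f)
  rw [shiftD, shiftD, Functor.map_comp, Category.assoc, Category.assoc]
  exact congrArg (d⟦i⟧' ≫ ·) h.symm

/-- Naturality of the shift isomorphism moves `d'` past it, so the left composite is the `i`-fold
shift of the right one followed by isomorphisms. -/
lemma shiftD_shiftD {i : ℤ} {A B C : M} (d : t.ιHeart.obj A ⟶ (heartShift t).obj B)
    (d' : t.ιHeart.obj B ⟶ (heartShift t).obj C) :
    shiftD t i d ≫ shiftD t (i + 1) d' = 0 ↔ d ≫ d'⟦(1 : ℤ)⟧' = 0 := by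
  have h := (shiftFunctorAdd' D 1 i (i + 1) (by lia)).inv.naturality d'
  have h' : shiftD t i d ≫ shiftD t (i + 1) d' = (d ≫ d'⟦(1 : ℤ)⟧')⟦i⟧' ≫
      (shiftFunctorAdd' D 1 i (i + 1) (by lia)).inv.app ((heartShift t).obj C) ≫
      (shiftFunctorAdd' D 1 (i + 1) (i + 1 + 1) (by lia)).inv.app (t.ιHeart.obj C) := by
    rw [Functor.map_comp, Category.assoc]
    have h₂ := congrArg (fun x => d⟦i⟧' ≫ x ≫
      (shiftFunctorAdd' D 1 (i + 1) (i + 1 + 1) (by lia)).inv.app (t.ιHeart.obj C)) h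
    simp only [Category.assoc] at h₂
    rw [shiftD, shiftD, Category.assoc]
    exact h₂.symm
  rw [h']
  refine ⟨fun h₀ => (shiftFunctor D i).map_injective ?_, fun h₀ => by
    rw [h₀, Functor.map_zero, zero_comp]⟩
  rw [Functor.map_zero, ← cancel_mono ((shiftFunctorAdd' D 1 i (i + 1) (by lia)).inv.app
    ((heartShift t).obj C) ≫ (shiftFunctorAdd' D 1 (i + 1) (i + 1 + 1) (by lia)).inv.app
      (t.ιHeart.obj C)), h₀, zero_comp]

namespace LinearComplex

/-- The complex in `Pure(D)` defined by a linear complex. -/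
noncomputable abbrev complexObj (A : LinearComplex t wt) : CochainComplex (PureCat t wt) ℤ :=
  CochainComplex.of (fun i => pureObj (t := t) (A.weight i))
    (fun i => ObjectProperty.homMk (shiftD t i (A.d i)))
    (fun i => ObjectProperty.hom_ext _ ((shiftD_shiftD _ _).2 (A.d_comp_d i)))

lemma complexObj_d_hom (A : LinearComplex t wt) (i : ℤ) :
    (A.complexObj.d i (i + 1)).hom = shiftD t i (A.d i) :=
  congrArg (fun x => x.hom) (CochainComplex.of_d (fun i => pureObj (t := t) (A.weight i))
    (fun i => ObjectProperty.homMk (shiftD t i (A.d i))) i)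

/-- The functor sending a linear complex to the corresponding complex in `Pure(D)`. -/
noncomputable def toComplex : LinearComplex t wt ⥤ CochainComplex (PureCat t wt) ℤ where
  obj A := A.complexObj
  map {A B} f := CochainComplex.ofHom
    (fun i => ObjectProperty.homMk ((heartShiftBy t i).map (app f i))) (fun i => by
      refine ObjectProperty.hom_ext _ ?_
      change (heartShiftBy t i).map (app f i) ≫ (B.complexObj.d i (i + 1)).hom =
        (A.complexObj.d i (i + 1)).hom ≫ (heartShiftBy t (i + 1)).map (app f (i + 1))
      rw [complexObj_d_hom, complexObj_d_hom, map_shiftD, shiftD_map, app_comm])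
  map_id A := by
    ext i
    exact (heartShiftBy t i).map_id _
  map_comp f g := by
    ext i
    exact (heartShiftBy t i).map_comp _ _

lemma toComplex_map_f_hom {A B : LinearComplex t wt} (f : A ⟶ B) (i : ℤ) :
    ((toComplex.map f).f i).hom = (heartShiftBy t i).map (app f i) := rfl

instance : (toComplex (t := t) (wt := wt)).Additive where
  map_add := by
    intros
    ext i
    exact (heartShiftBy t i).map_add

instance {F : Type*} [Ring F] [CategoryTheory.Linear F D] [CategoryTheory.Linear F M]
    [(t.ιHeart (H := M)).Linear F] [∀ n : ℤ, (shiftFunctor D n).Linear F] :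
    (toComplex (t := t) (wt := wt)).Linear F where
  map_smul f r := by
    ext i
    exact (heartShiftBy t i).map_smul _ _

instance : (toComplex (t := t) (wt := wt)).Faithful where
  map_injective {A B} f g h := hom_ext fun i => (heartShiftBy t i).map_injective (by
    rw [← toComplex_map_f_hom, h, toComplex_map_f_hom])

instance : (toComplex (t := t) (wt := wt)).Full where
  map_surjective {A B} f := by
    have hg (i : ℤ) : ∃ g : A.X i ⟶ B.X i, (heartShiftBy t i).map g = (f.f i).hom :=
      (heartShiftBy t i).map_surjective _
    choose g hg using hg
    refine ⟨mkHom g fun i => (shiftD_bijective t i _ _).1 ?_, ?_⟩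
    · rw [← shiftD_map, ← map_shiftD, hg, hg, ← complexObj_d_hom, ← complexObj_d_hom]
      exact (congrArg (fun x => x.hom) (f.comm i (i + 1))).symm
    · ext i
      exact hg i

/-- A homotopy has components `A_i[i] ⟶ B_j[j]` with `j + 1 = i`. The source lies in cohomological
degree `-i` and the target in the higher degree `-j`, so they all vanish. -/
lemma eq_of_homotopy {A B : LinearComplex t wt} {f g : toComplex.obj A ⟶ toComplex.obj B}
    (h : Homotopy f g) : f = g := by
  have h₀ : h.hom = 0 := by
    funext i j
    by_cases hij : (ComplexShape.up ℤ).Rel j i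
    · have := isLE_heart_shift t (A.X i) i
      have := isGE_heart_shift t (B.X j) j
      have hij' : j + 1 = i := hij
      exact ObjectProperty.hom_ext _ (t.zero (X := (t.ιHeart.obj (A.X i))⟦i⟧)
        (Y := (t.ιHeart.obj (B.X j))⟦j⟧) _ (-i) (-j) (by lia))
    · exact h.zero i j hij
  ext i
  rw [h.comm i, h₀]
  simp

end LinearComplex

end Complex

/-! ### Linear complexes are equivalent to the winnowing -/

section ToWinnowing

variable {D : Type*} [Category* D] [Preadditive D] [HasZeroObject D] [HasShift D ℤ]
  [∀ n : ℤ, (shiftFunctor D n).Additive] [Pretriangulated D] [IsTriangulated D]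
  {t : TStructure D} {M : Type*} [Category* M] [Abelian M] [t.Heart M]
  {wt : Irr M → ℤ}

namespace LinearComplex

lemma isZero_complexObj_X {A : LinearComplex t wt} {i : ℤ} (h : IsZero (A.X i)) :
    IsZero (A.complexObj.X i) :=
  isZero_pureCat ((heartShiftBy t i).map_isZero h)

/-- The functor from linear complexes to the homotopy category of `Pure(D)`. -/
noncomputable abbrev toHomotopy :
    LinearComplex t wt ⥤ HomotopyCategory (PureCat t wt) (ComplexShape.up ℤ) :=
  toComplex ⋙ HomotopyCategory.quotient _ _

lemma bounded_toHomotopy_obj (A : LinearComplex t wt) :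
    Winnow.bounded (PureCat t wt) (toHomotopy.obj A) := by
  obtain ⟨a, b, h⟩ := A.bounded
  refine ⟨a, b, ?_, ?_⟩
  · rw [CochainComplex.isStrictlyGE_iff]
    exact fun i hi => isZero_complexObj_X (h i (Or.inl hi))
  · rw [CochainComplex.isStrictlyLE_iff]
    exact fun i hi => isZero_complexObj_X (h i (Or.inr hi))

/-- The functor from linear complexes to the bounded homotopy category of `Pure(D)`. -/
noncomputable def toKb : LinearComplex t wt ⥤ Kb (PureCat t wt) :=
  (Winnow.bounded (PureCat t wt)).lift toHomotopy bounded_toHomotopy_obj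

/-- The functor from linear complexes to the winnowing. -/
noncomputable def toWinnowing (hm : IsMixed t wt) : LinearComplex t wt ⥤ Winnowing t wt :=
  (winnowing t wt).lift toKb fun A => ⟨toKb.obj A, ⟨Iso.refl _⟩, fun i =>
    sumOfDegree_pureObj hm (A.weight i)⟩

variable (hm : IsMixed t wt)

instance : (toWinnowing hm).Additive where
  map_add {A B f g} := by
    refine ObjectProperty.hom_ext _ (ObjectProperty.hom_ext _ ?_)
    exact toHomotopy.map_add

instance {F : Type*} [Field F] [CategoryTheory.Linear F D] [CategoryTheory.Linear F M]
    [(t.ιHeart (H := M)).Linear F] [∀ n : ℤ, (shiftFunctor D n).Linear F] :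
    (toWinnowing hm).Linear F where
  map_smul f r := by
    refine ObjectProperty.hom_ext _ (ObjectProperty.hom_ext _ ?_)
    exact toHomotopy.map_smul _ _

instance : (toWinnowing hm).Faithful where
  map_injective {A B} f g h := by
    have h' : (HomotopyCategory.quotient _ _).map (toComplex.map f) =
        (HomotopyCategory.quotient _ _).map (toComplex.map g) :=
      congrArg (fun x => x.hom.hom) h
    exact toComplex.map_injective (eq_of_homotopy (HomotopyCategory.homotopyOfEq _ _ h'))

instance : (toWinnowing hm).Full where
  map_surjective {A B} f := by
    obtain ⟨g, hg⟩ := toHomotopy.map_surjective f.hom.hom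
    exact ⟨g, ObjectProperty.hom_ext _ (ObjectProperty.hom_ext _ hg)⟩

/-- A bounded complex whose terms are sums of indecomposable objects of the right degrees comes
from a linear complex. -/
lemma exists_toComplex_iso (hm : IsMixed t wt) (K : CochainComplex (PureCat t wt) ℤ)
    (hb : ∃ a b : ℤ, CochainComplex.IsStrictlyGE K a ∧ CochainComplex.IsStrictlyLE K b)
    (h : ∀ i : ℤ, sumOfDegree t wt (-i) (K.X i)) :
    ∃ A : LinearComplex t wt, Nonempty (toComplex.obj A ≅ K) := by
  choose A hA e using fun i => exists_pureObj_of_sumOfDegree hm (h i)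
  let e' (i : ℤ) : (K.X i).obj ≅ (heartShiftBy t i).obj (A i) := (e i).some
  choose d hd using fun i => (shiftD_bijective t i (A i) (A (i + 1))).2
    ((e' i).inv ≫ (K.d i (i + 1)).hom ≫ (e' (i + 1)).hom)
  let B : LinearComplex t wt :=
    { X := A
      weight := hA
      d := d
      d_comp_d := fun i => by
        have h₀ : (K.d i (i + 1)).hom ≫ (K.d (i + 1) (i + 1 + 1)).hom = 0 :=
          congrArg (fun x => x.hom) (K.d_comp_d i (i + 1) (i + 1 + 1))
        rw [← shiftD_shiftD (i := i), hd, hd]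
        simp [reassoc_of% h₀]
      bounded := by
        obtain ⟨a, b, ha, hb⟩ := hb
        rw [CochainComplex.isStrictlyGE_iff] at ha
        rw [CochainComplex.isStrictlyLE_iff] at hb
        refine ⟨a, b, fun i hi => isZero_of_isZero_heartShiftBy (t := t) (i := i)
          (IsZero.of_iso ((isPure t wt).ι.map_isZero ?_) (e' i).symm)⟩
        rcases hi with hi | hi
        · exact ha i hi
        · exact hb i hi }
  refine ⟨B, ⟨(HomologicalComplex.Hom.isoOfComponents
    (fun i => (isPure t wt).isoMk (Y := pureObj (hA i)) (e' i)) ?_).symm⟩⟩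
  rintro i _ rfl
  refine ObjectProperty.hom_ext _ ?_
  change (e' i).hom ≫ (B.complexObj.d i (i + 1)).hom =
    (K.d i (i + 1)).hom ≫ (e' (i + 1)).hom
  rw [complexObj_d_hom, hd, Iso.hom_inv_id_assoc]

instance : (toWinnowing hm).EssSurj where
  mem_essImage Y := by
    obtain ⟨C, ⟨e⟩, hC⟩ := Y.property
    obtain ⟨A, ⟨e'⟩⟩ := exists_toComplex_iso hm C.obj.as C.property hC
    refine ⟨A, ⟨(winnowing t wt).isoMk ((Winnow.bounded _).isoMk
      ((HomotopyCategory.quotient _ _).mapIso e') ≪≫ e.symm)⟩⟩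

instance : (toWinnowing hm).IsEquivalence where

lemma winnowingSimple_toWinnowing_obj {n : ℤ} {A : LinearComplex t wt} (hA : Simple A)
    (hn : ∃ hL : Simple (A.X (-n)), wt (irrClass _ hL) = n) (h₀ : ∀ i, i ≠ -n → IsZero (A.X i)) :
    winnowingSimple t wt n ((toWinnowing hm).obj A) := by
  obtain ⟨hL, hw⟩ := hn
  exact ⟨(simple_obj_iff (toWinnowing hm) A).2 hA, toKb.obj A, ⟨Iso.refl _⟩,
    ⟨A.X (-n), hL, hw, ⟨Iso.refl _⟩⟩, fun i hi => isZero_complexObj_X (h₀ i hi)⟩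

/-- Transport along the isomorphism gives a homotopy equivalence from the complex of `A`, and its
homotopy on that side is zero. The identity in degree `i` thus factors through a zero term of `C`.
-/
lemma supported_of_winnowingSimple {n : ℤ} {A : LinearComplex t wt} {Y : Winnowing t wt}
    (hY : winnowingSimple t wt n Y) (e : (toWinnowing hm).obj A ≅ Y) : supported t wt {n} A := by
  obtain ⟨-, C, ⟨e'⟩, -, hC⟩ := hY
  intro i hi
  let u : (HomotopyCategory.quotient _ _).obj (toComplex.obj A) ≅
      (HomotopyCategory.quotient _ _).obj C.obj.as :=
    (Winnow.bounded _).ι.mapIso ((winnowing t wt).ι.mapIso e ≪≫ e')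
  let v := HomotopyCategory.homotopyEquivOfIso u
  have h := congrArg (fun x => x.f i) (eq_of_homotopy v.homotopyHomInvId)
  have h₀ : v.hom.f i = 0 := (hC i (by
    rintro rfl
    simp at hi)).eq_of_tgt _ _
  refine isZero_of_isZero_heartShiftBy (t := t) (i := i) ?_
  rw [IsZero.iff_id_eq_zero]
  have h' : 𝟙 ((toComplex.obj A).X i) = 0 := by
    rw [← HomologicalComplex.id_f, ← h, HomologicalComplex.comp_f, h₀, zero_comp]
  exact congrArg (fun x => x.hom) h'

end LinearComplex

end ToWinnowing

/-- An exact functor is compatible with the formation of Serre subcategories. -/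
lemma serreGenerated_obj_of_exact {A B : Type*} [Category* A] [Category* B] [Preadditive A]
    [Preadditive B] (hA : IsAbelian A) (hB : IsAbelian B) (G : A ⥤ B) [PreservesFiniteLimits G]
    [PreservesFiniteColimits G] {P : ObjectProperty A} {Q : ObjectProperty B}
    (h : ∀ X, P X → Q (G.obj X)) {X : A} (hX : serreGenerated P X) :
    serreGenerated Q (G.obj X) := by
  obtain ⟨a, rfl⟩ := hA
  obtain ⟨b, rfl⟩ := hB
  exact serreGenerated_le (Q := (serreGenerated Q).inverseImage G)
    (fun X hX => le_serreGenerated _ _ (h X hX)) _ hX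

/-! ### The functor `β` and its restrictions -/

section Main

variable {D : Type*} [Category* D] [Preadditive D] [HasZeroObject D] [HasShift D ℤ]
  [∀ n : ℤ, (shiftFunctor D n).Additive] [Pretriangulated D] [IsTriangulated D]
  {t : TStructure D} {M : Type*} [Category* M] [Abelian M] [t.Heart M]
  {wt : Irr M → ℤ}

open LinearComplex

namespace IsMixed

variable (hm : IsMixed t wt)

lemma isAbelian_winnowing (hm : IsMixed t wt) : IsAbelian (Winnowing t wt) := by
  let := LinearComplex.abelian hm
  have : HasFiniteProducts (Winnowing t wt) :=
    ⟨fun n => Adjunction.hasLimitsOfShape_of_equivalence (toWinnowing hm).inv⟩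
  exact ⟨abelianOfEquivalence (toWinnowing hm).inv, rfl⟩

/-- The functor from the heart to its winnowing. -/
noncomputable def winnow : M ⥤ Winnowing t wt := hm.toLinear ⋙ toWinnowing hm

instance : hm.winnow.Additive :=
  inferInstanceAs (hm.toLinear ⋙ toWinnowing hm).Additive

instance {F : Type*} [Field F] [CategoryTheory.Linear F D] [CategoryTheory.Linear F M]
    [(t.ιHeart (H := M)).Linear F] [∀ n : ℤ, (shiftFunctor D n).Linear F] :
    hm.winnow.Linear F :=
  inferInstanceAs ((hm.toLinear ⋙ toWinnowing hm).Linear F)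

instance : hm.winnow.Faithful :=
  inferInstanceAs (hm.toLinear ⋙ toWinnowing hm).Faithful

instance : PreservesFiniteLimits hm.winnow :=
  have := hm.preservesFiniteLimits_and_colimits_toLinear.1
  comp_preservesFiniteLimits hm.toLinear (toWinnowing hm)

instance : PreservesFiniteColimits hm.winnow :=
  have := hm.preservesFiniteLimits_and_colimits_toLinear.2
  comp_preservesFiniteColimits hm.toLinear (toWinnowing hm)

lemma preservesWeights_winnow : PreservesWeights t wt hm.winnow := by
  intro L hL
  have hw := weightPart_of_simple (S := {-(-wt (irrClass L hL))}) wt hL (by simp)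
  have hs : Simple (hm.grObj (-wt (irrClass L hL)) L) := Simple.of_iso (hm.grIso hw)
  refine winnowingSimple_toWinnowing_obj hm (hm.simple_toLinear_obj hL) ⟨hs, ?_⟩
    fun i hi => hm.isZero_grObj hw ?_
  · exact congrArg wt (irrClass_eq_of_iso hs hL (hm.grIso hw))
  · rw [Set.mem_singleton_iff]
    lia

lemma winnowingWeightPart_winnow {S : Set ℤ} {X : M} (h : weightPart wt S X) :
    winnowingWeightPart t wt S (hm.winnow.obj X) :=
  serreGenerated_obj_of_exact ⟨inferInstance, rfl⟩ hm.isAbelian_winnowing hm.winnow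
    (fun L ⟨hL, hw⟩ => ⟨_, hw, hm.preservesWeights_winnow L hL⟩) h

/-- The inverse equivalence is exact and sends simple objects of weight in `S` to linear complexes
supported in `S`, which form a Serre class. -/
lemma supported_inv_obj {S : Set ℤ} {Y : Winnowing t wt} (h : winnowingWeightPart t wt S Y) :
    LinearComplex.supported t wt S ((toWinnowing hm).inv.obj Y) := by
  let := LinearComplex.abelian hm
  have := LinearComplex.isSerreClass_supported hm S
  refine serreGenerated_le (P := LinearComplex.supported t wt S) le_rfl _
    (serreGenerated_obj_of_exact hm.isAbelian_winnowing ⟨inferInstance, rfl⟩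
      (toWinnowing hm).inv (fun L ⟨n, hn, hL⟩ i hi => ?_) h)
  exact supported_of_winnowingSimple hm hL ((toWinnowing hm).asEquivalence.counitIso.app L) i
    fun h => hi (by rwa [Set.mem_singleton_iff.1 h])

/-- Full faithfulness and essential surjectivity for two consecutive weights pass to any smaller
`S`, because weights can be read off from the graded pieces. -/
lemma restrictsToEquivalence_winnow {i : ℤ} {S : Set ℤ} (hS : S ⊆ Set.Icc (-(i + 1)) (-i)) :
    RestrictsToEquivalence hm.winnow (weightPart wt S) (winnowingWeightPart t wt S) := by
  refine ⟨fun X hX => hm.winnowingWeightPart_winnow hX, ?_⟩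
  have hfull : ((weightPart wt S).ι ⋙ hm.winnow).Full := ⟨fun {X Y} f => by
    obtain ⟨g, hg⟩ := (toWinnowing hm).map_surjective f
    obtain ⟨f', hf'⟩ := hm.exists_toLinear_map_eq (weightPart_mono wt hS _ X.property)
      (weightPart_mono wt hS _ Y.property) g
    refine ⟨ObjectProperty.homMk f', ?_⟩
    rw [← hg, ← hf']
    rfl⟩
  have hess : ((winnowingWeightPart t wt S).lift ((weightPart wt S).ι ⋙ hm.winnow)
      fun X => hm.winnowingWeightPart_winnow X.property).EssSurj := ⟨fun Y => by
    have hY := hm.supported_inv_obj Y.property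
    obtain ⟨X, -, ⟨e⟩⟩ := hm.exists_toLinear_obj_iso fun j hj => hY j fun h => hj (hS h)
    have hX : weightPart wt S X := (hm.weightPart_iff_supported S X).2 fun j hj =>
      (hY j hj).of_iso ⟨app e.hom j, app e.inv j, by rw [← comp_app, e.hom_inv_id, id_app],
        by rw [← comp_app, e.inv_hom_id, id_app]⟩
    exact ⟨⟨X, hX⟩, ⟨(winnowingWeightPart t wt S).isoMk ((toWinnowing hm).mapIso e ≪≫
      (toWinnowing hm).asEquivalence.counitIso.app Y.obj)⟩⟩⟩
  exact { }

end IsMixed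

end Main

end Winnow

theorem mainTheorem7 {F : Type*} [Field F]
    {D : Type*} [Category* D] [Preadditive D] [HasZeroObject D] [HasShift D ℤ]
    [∀ n : ℤ, (shiftFunctor D n).Additive] [Pretriangulated D] [IsTriangulated D]
    [Linear F D] [∀ n : ℤ, (shiftFunctor D n).Linear F]
    (t : TStructure D)
    {M : Type*} [Category* M] [Abelian M] [Linear F M]
    [t.Heart M] [(t.ιHeart (H := M)).Linear F]
    (wt : Winnow.Irr M → ℤ) (hmixed : Winnow.IsMixed t wt)
    (hEnd : ∀ L : M, Simple L → Nonempty (End L ≃ₐ[F] F))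
    (hHom : ∀ X Y : Winnow.PureCat t wt, FiniteDimensional F (X ⟶ Y)) :
    Winnow.IsAbelian (Winnow.Winnowing t wt) ∧
    ∃ β : M ⥤ Winnow.Winnowing t wt,
      (PreservesFiniteLimits β ∧ PreservesFiniteColimits β) ∧
      (∃ _ : β.Additive, β.Linear F) ∧
      β.Faithful ∧
      Winnow.PreservesWeights t wt β ∧
      (∀ n : ℤ, Winnow.RestrictsToEquivalence β
        (Winnow.weightPart wt {n}) (Winnow.winnowingWeightPart t wt {n})) ∧
      (∀ n : ℤ, Winnow.RestrictsToEquivalence β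
        (Winnow.weightPart wt (Set.Icc n (n + 1)))
        (Winnow.winnowingWeightPart t wt (Set.Icc n (n + 1)))) := by
  refine ⟨hmixed.isAbelian_winnowing, hmixed.winnow, ⟨inferInstance, inferInstance⟩,
    ⟨inferInstance, inferInstance⟩, inferInstance, hmixed.preservesWeights_winnow,
    -- The window of weights is `[-(i + 1), -i]`: `i = -n` gives `[n - 1, n]`, which contains `n`,
    -- and `i = -n - 1` gives `[n, n + 1]`.
    fun n => hmixed.restrictsToEquivalence_winnow (i := -n) ?_,
    fun n => hmixed.restrictsToEquivalence_winnow (i := -n - 1) ?_⟩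
  · rw [Set.singleton_subset_iff, Set.mem_Icc]
    lia
  · exact Set.Icc_subset_Icc (by lia) (by lia)
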